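/- Let $N,K,m$ be positive integers, $P>0$, $\mathbf H\in\mathbb C^{N\times K}$, $\mathbf g\in\mathbb C^{K}$, let $\mathcal A\subset\mathbb R$ be a finite nonempty set of phases and $\mathcal B\subset\mathbb C$ a finite constellation for which at least one distribution $p$ on $\mathcal B$ satisfies $\sum_{x\in\mathcal B}p(x)|x|^2\le P$. For $\boldsymbol\theta\in\mathcal A^K$ write $\mathbf S=\mathrm{diag}(e^{j\theta_1},\dots,e^{j\theta_K})$. Consider the channel $\mathbf y_i(t)=\mathbf H\mathbf S(t)\mathbf g\,x_i(t)+\mathbf z_i(t)$, $t=1,\dots,T$, $i=1,\dots,m$, with i.i.d. noise vectors $\mathbf z_i(t)\sim\mathcal{CN}(0,\mathbf I_N)$. A code of length $n=mT$ maps a uniformly distributed message $w\in\{1,\dots,M\}$ to symbols $x_i(t)\in\mathcal B$ with $\mathbb E[|x_i(t)|^2]\le P$ for all $i,t$ and to RIS configurations $\boldsymbol\theta(t)\in\mathcal A^K$, and decodes $\hat w$ from all the received vectors. A rate $R$ is achievable with a fixed configuration $\boldsymbol\theta$ if there are such codes for all $T$, with $\boldsymbol\theta(t)=\boldsymbol\theta$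 for every block $t$ and every message, such that $\Pr(\hat w\ne w)\to0$ as $n\to\infty$ and $\liminf_{n\to\infty}\frac1n\log_2M\ge R$. Define $$f_{\text{max-SNR}}(x,\boldsymbol\theta,\mathbf z)=\log_2\Big(\sum_{x'\in\mathcal B}p(x')\exp\big(-\lVert\mathbf z+\mathbf H\mathbf S\mathbf g(x-x')\rVert^2\big)\Big),$$ $$R_{\text{max-SNR}}=-N\log_2(e)-\min_{p,\ \boldsymbol\theta}\ \sum_{x\in\mathcal B}p(x)\,\mathbb E\big[f_{\text{max-SNR}}(x,\boldsymbol\theta,\mathbf z)\big],$$ where the minimum is over the probability distributions $p$ on $\mathcal B$ with $\sum_x p(x)|x|^2\le P$ and over $\boldsymbol\theta\in\mathcal A^K$, and $\mathbf z\sim\mathcal{CN}(0,\mathbf I_N)$. Then: (i) for every such $p$ and $\boldsymbol\theta$ the expectations are finite, and $-N\log_2(e)-\sum_{x}p(x)\mathbb E[f_{\text{max-SNR}}(x,\boldsymbol\theta,\mathbf z)]$ is the (finite) mutual information $I(x;\mathbf y)$, in bits, of $x\sim p$ and $\mathbf y=\mathbf H\mathbf S\mathbf g x+\mathbf z$ with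 $\mathbf z\sim\mathcal{CN}(0,\mathbf I_N)$ independent of $x$; (ii) the minimum is attained, so that $R_{\text{max-SNR}}$ is the maximum of $I(x;\mathbf y)$ over all such $p$ and $\boldsymbol\theta$; (iii) the rate $R_{\text{max-SNR}}$ is achievable with the RIS configuration fixed to any $\boldsymbol\theta\in\mathcal A^K$ that maximizes the SNR $\lVert\mathbf H\mathbf S\mathbf g\rVert^2P$ at the receiver. -/

import Mathlib

open MeasureTheory ProbabilityTheory

namespace RIS

noncomputable section

/-- The circularly symmetric complex Gaussian law `CN(0,1)`: independent real and imaginary parts,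
each real Gaussian with mean `0` and variance `1/2`. -/
def stdComplexGaussian : Measure ℂ :=
  ((gaussianReal 0 (1 / 2)).prod (gaussianReal 0 (1 / 2))).map Complex.measurableEquivRealProd.symm

/-- The law `CN(0, I_N)` of a vector with i.i.d. `CN(0,1)` entries. -/
def noiseVec (N : ℕ) : Measure (Fin N → ℂ) :=
  Measure.pi fun _ => stdComplexGaussian

/-- The law of the noise over `T` blocks of `m` symbols; the `i`-th column of the noise matrix of
block `t` is `Z t i`, and all entries are i.i.d. `CN(0,1)`. -/
def noise (N m T : ℕ) : Measure (Fin T → Fin m → Fin N → ℂ) :=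
  Measure.pi fun _ => Measure.pi fun _ => noiseVec N

/-- The squared Euclidean norm of a complex vector. -/
def sqNorm {N : ℕ} (v : Fin N → ℂ) : ℝ := ∑ i, ‖v i‖ ^ 2

/-- The RIS configuration matrix `S = diag(e^{jθ_1}, …, e^{jθ_K})`. -/
def configMatrix {K : ℕ} {A : Finset ℝ} (θ : Fin K → A) : Matrix (Fin K) (Fin K) ℂ :=
  Matrix.diagonal fun k => Complex.exp (Complex.I * ((θ k : ℝ) : ℂ))

/-- The effective channel vector `H S g`. -/
def effChannel {N K : ℕ} (H : Matrix (Fin N) (Fin K) ℂ) (g : Fin K → ℂ) {A : Finset ℝ}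
    (θ : Fin K → A) : Fin N → ℂ :=
  Matrix.mulVec (H * configMatrix θ) g

/-- The signal-to-noise ratio at the receiver, `‖H S g‖² P`. -/
def snr {N K : ℕ} (H : Matrix (Fin N) (Fin K) ℂ) (g : Fin K → ℂ) (P : ℝ) {A : Finset ℝ}
    (θ : Fin K → A) : ℝ :=
  sqNorm (effChannel H g θ) * P

/-- `p` is a probability distribution on the constellation `B` with `E[|x|²] ≤ P`. -/
def IsFeasible {B : Finset ℂ} (P : ℝ) (p : B → ℝ) : Prop :=
  p ∈ stdSimplex ℝ B ∧ ∑ x : B, p x * ‖(x : ℂ)‖ ^ 2 ≤ P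

/-- The function `f_max-SNR(x, θ, z)` (which also depends on `p`). -/
def fMaxSNR {N K : ℕ} (H : Matrix (Fin N) (Fin K) ℂ) (g : Fin K → ℂ) {A : Finset ℝ} {B : Finset ℂ}
    (p : B → ℝ) (x : B) (θ : Fin K → A) (z : Fin N → ℂ) : ℝ :=
  Real.logb 2 (∑ x' : B, p x' *
    Real.exp (-sqNorm (z + ((x : ℂ) - (x' : ℂ)) • effChannel H g θ)))

/-- The objective `∑_x p(x) E[f_max-SNR(x, θ, z)]` with `z ~ CN(0, I_N)`. -/
def objective {N K : ℕ} (H : Matrix (Fin N) (Fin K) ℂ) (g : Fin K → ℂ) {A : Finset ℝ}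
    {B : Finset ℂ} (p : B → ℝ) (θ : Fin K → A) : ℝ :=
  ∑ x : B, p x * ∫ z, fMaxSNR H g p x θ z ∂(noiseVec N)

/-- The joint law of `(x, y)` where `x ~ p` and `y = H S g x + z` with `z ~ CN(0, I_N)`
independent of `x`. -/
def jointLaw {N K : ℕ} (H : Matrix (Fin N) (Fin K) ℂ) (g : Fin K → ℂ) {A : Finset ℝ}
    {B : Finset ℂ} (p : B → ℝ) (θ : Fin K → A) : Measure (B × (Fin N → ℂ)) :=
  ∑ x : B, ENNReal.ofReal (p x) • (Measure.dirac x).prod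
    ((noiseVec N).map fun z => (x : ℂ) • effChannel H g θ + z)

/-- The mutual information (in nats, possibly infinite) of a pair with joint law `μ`: the
relative entropy of `μ` with respect to the product of its marginals. -/
def mutualInfo {α β : Type*} [MeasurableSpace α] [MeasurableSpace β] (μ : Measure (α × β)) :
    ENNReal :=
  InformationTheory.klDiv μ (μ.fst.prod μ.snd)

/-- The mutual information `I(x; y)` in bits of the channel with fixed configuration `θ` and
input distribution `p`. -/
def mutualInfoBits {N K : ℕ} (H : Matrix (Fin N) (Fin K) ℂ) (g : Fin K → ℂ) {A : Finset ℝ}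
    {B : Finset ℂ} (p : B → ℝ) (θ : Fin K → A) : ℝ :=
  (mutualInfo (jointLaw H g p θ)).toReal / Real.log 2

/-- A code over `T` blocks of `m` symbols (so of length `n = m T`). Each of the `M` messages is
encoded jointly into the transmitted symbols and the RIS configurations, the latter being constant
on each block. -/
structure Code (N K m T : ℕ) (A : Finset ℝ) (B : Finset ℂ) where
  /-- the number of messages -/
  M : ℕ
  /-- the transmitted symbols `x_i(t)` -/
  symbol : Fin M → Fin T → Fin m → B
  /-- the RIS configurations `θ(t)` -/
  phase : Fin M → Fin T → Fin K → A
  /-- the decoder -/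
  decode : (Fin T → Fin m → Fin N → ℂ) → Fin M
  measurable_decode : Measurable decode

namespace Code

variable {N K m T : ℕ} {A : Finset ℝ} {B : Finset ℂ}

/-- The rate in bits per symbol, `log₂(M) / n`. -/
def rate (c : Code N K m T A B) : ℝ := Real.logb 2 c.M / (m * T : ℝ)

/-- The power constraint `E[|x_i(t)|²] ≤ P` for every symbol, the message being uniform. -/
def PowerConstraint (c : Code N K m T A B) (P : ℝ) : Prop :=
  ∀ t i, (∑ w, ‖(c.symbol w t i : ℂ)‖ ^ 2) / c.M ≤ P

/-- The received signal for message `w` and noise `Z`: `y_i(t) = H S(t) g x_i(t) + z_i(t)`. -/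
def received (c : Code N K m T A B) (H : Matrix (Fin N) (Fin K) ℂ) (g : Fin K → ℂ) (w : Fin c.M)
    (Z : Fin T → Fin m → Fin N → ℂ) : Fin T → Fin m → Fin N → ℂ :=
  fun t i => (c.symbol w t i : ℂ) • effChannel H g (c.phase w t) + Z t i

/-- The probability of error `Pr(ŵ ≠ w)` for a uniform message `w`. -/
def errorProb (c : Code N K m T A B) (H : Matrix (Fin N) (Fin K) ℂ) (g : Fin K → ℂ) : ℝ :=
  (∑ w, (noise N m T).real {Z | c.decode (c.received H g w Z) ≠ w}) / c.M

end Code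

/-- The rate `R` is achievable with the RIS configuration fixed to `θ` for the whole transmission,
irrespective of the message: there are codes of lengths `n = m T`, all using only the configuration
`θ` and satisfying the power constraint, whose rates are asymptotically at least `R` and whose
probability of error tends to `0`. -/
def AchievableWithFixedConfig {N K : ℕ} (H : Matrix (Fin N) (Fin K) ℂ) (g : Fin K → ℂ)
    {A : Finset ℝ} (B : Finset ℂ) (P : ℝ) (m : ℕ) (θ : Fin K → A) (R : ℝ) : Prop :=
  ∃ c : ∀ T : ℕ, Code N K m T A B,
    (∀ T w t, (c T).phase w t = θ) ∧
    (∀ T, (c T).PowerConstraint P) ∧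
    (∀ δ > 0, ∀ᶠ T in Filter.atTop, R - δ ≤ (c T).rate) ∧
    Filter.Tendsto (fun T => (c T).errorProb H g) Filter.atTop (nhds 0)

end

end RIS

/-!
The information density `i(x; y) = log (q_x(y) / q(y))` of the channel `y = x h + z`, where
`h = H S g`, carries the proof; here `q_x` is the density of `y` given `x`, and `q` its average over
`x ~ p`, which is `mixDensity p h` up to a constant.

*Mutual information.* The joint law of `(x, y)` has the density `exp i` with respect to the product
of its marginals (`channelLaw_eq_withDensity`), so the mutual information is the mean of `i`. Since
`q_x` is Gaussian and `E ‖z‖² = N`, this mean is the expression in `f_max-SNR`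
(`mutualInfo_channelLaw`, `meanInfo_eq`). All logarithms are bounded by a quadratic function of `z`,
uniformly in `p` (`abs_log_mixDensity_le`); this gives integrability, finite variances, and the
continuity in `p` from which an optimal input distribution is obtained.

*Monotonicity.* The mutual information grows with `‖h‖` (`meanInfo_mono`): when `‖h'‖ ≤ ‖h‖`, a
rank-one contraction `W` maps `h` to `h'`, and `W y` plus independent Gaussian noise of covariance
`I - W Wᴴ` has the law of the output of the channel `h'` (`exists_degrading_map`). The data
processing inequality concludes. So a configuration of maximal SNR is optimal for every `p`.

*Achievability.* The codewords are drawn independently from `p`, and the decoder looks for a message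
whose codeword has information density with the output above a threshold. The true codeword passes
by the law of large numbers (`exists_lintegral_blockInfo_le`). A codeword independent of the output
passes with probability at most `exp (-γ)`, because `exp i` has mean one
(`measure_lt_blockInfo_le`). The power constraint bears on the average over the messages of every
single symbol; a random codebook meets it with high probability when `p` satisfies it with a margin,
since the number of messages is exponential in the length (`exists_measure_power_le`). A margin is
obtained by mixing a little of the symbol of least power into `p`, unless all the symbols used by
`p` have power exactly `P`, and then there is nothing to check (`exists_hasPowerMargin`).
-/

namespace RIS

/-! ### The complex Gaussian noise -/

instance : IsProbabilityMeasure stdComplexGaussian :=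
  Measure.isProbabilityMeasure_map Complex.measurableEquivRealProd.symm.measurable.aemeasurable

instance (N : ℕ) : IsProbabilityMeasure (noiseVec N) := by unfold noiseVec; infer_instance

instance (N m T : ℕ) : IsProbabilityMeasure (noise N m T) := by unfold noise; infer_instance

/-- A finite product of measures with integrable densities has the product density. -/
lemma pi_withDensity_ofReal {ι α : Type*} [Fintype ι] [MeasurableSpace α] (μ : Measure α)
    [SigmaFinite μ] {f : α → ℝ} (hf0 : ∀ x, 0 ≤ f x) (hf : Integrable f μ) :
    Measure.pi (fun _ : ι => μ.withDensity fun x => ENNReal.ofReal (f x)) =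
      (Measure.pi fun _ : ι => μ).withDensity fun x => ENNReal.ofReal (∏ i, f (x i)) := by
  have : IsFiniteMeasure (μ.withDensity fun x => ENNReal.ofReal (f x)) :=
    isFiniteMeasure_withDensity_ofReal hf.2
  refine Measure.pi_eq fun s hs => ?_
  rw [withDensity_apply _ (MeasurableSet.univ_pi hs), Measure.restrict_pi_pi,
    ← ofReal_integral_eq_lintegral_ofReal
      (Integrable.fintype_prod (f := fun _ => f) fun i => hf.restrict)
      (Filter.Eventually.of_forall fun x => Finset.prod_nonneg fun i _ => hf0 _),
    integral_fintype_prod_eq_prod (f := fun _ => f),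
    ENNReal.ofReal_prod_of_nonneg fun i _ => integral_nonneg hf0]
  refine Finset.prod_congr rfl fun i _ => ?_
  rw [withDensity_apply _ (hs i), ofReal_integral_eq_lintegral_ofReal hf.restrict
    (Filter.Eventually.of_forall hf0)]

lemma gaussianPDFReal_mul_gaussianPDFReal (z : ℂ) :
    gaussianPDFReal 0 (1 / 2) z.re * gaussianPDFReal 0 (1 / 2) z.im =
      Real.pi⁻¹ * Real.exp (-‖z‖ ^ 2) := by
  have h2 : ((1 / 2 : NNReal) : ℝ) = 1 / 2 := by simp
  have hs : √(2 * Real.pi * (1 / 2)) ^ 2 = Real.pi := by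
    rw [Real.sq_sqrt (by positivity)]; ring
  rw [gaussianPDFReal, gaussianPDFReal, h2, mul_mul_mul_comm, ← mul_inv, ← sq, hs,
    ← Real.exp_add, ← Complex.normSq_eq_norm_sq, Complex.normSq_apply]
  congr 2
  ring

lemma integrable_exp_neg_norm_sq_complex :
    Integrable (fun z : ℂ => Real.pi⁻¹ * Real.exp (-‖z‖ ^ 2)) volume := by
  have h : Integrable (fun q : ℝ × ℝ => gaussianPDFReal 0 (1 / 2) q.1 *
      gaussianPDFReal 0 (1 / 2) q.2) (volume.prod volume) :=
    (integrable_gaussianPDFReal 0 (1 / 2)).mul_prod (integrable_gaussianPDFReal 0 (1 / 2))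
  have h' := (Complex.volume_preserving_equiv_real_prod).integrable_comp_of_integrable h
  refine h'.congr (Filter.Eventually.of_forall fun z => ?_)
  exact gaussianPDFReal_mul_gaussianPDFReal z

lemma stdComplexGaussian_eq_withDensity :
    stdComplexGaussian =
      volume.withDensity fun z => ENNReal.ofReal (Real.pi⁻¹ * Real.exp (-‖z‖ ^ 2)) := by
  have h0 : (1 / 2 : NNReal) ≠ 0 := by simp
  rw [stdComplexGaussian, gaussianReal_of_var_ne_zero _ h0,
    prod_withDensity (measurable_gaussianPDF _ _) (measurable_gaussianPDF _ _)]
  ext s hs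
  rw [Measure.map_apply Complex.measurableEquivRealProd.symm.measurable hs,
    withDensity_apply _ (Complex.measurableEquivRealProd.symm.measurable hs),
    withDensity_apply _ hs,
    ← Complex.volume_preserving_equiv_real_prod.symm.setLIntegral_comp_preimage hs (by fun_prop)]
  refine lintegral_congr fun q => ?_
  have := gaussianPDFReal_mul_gaussianPDFReal (Complex.measurableEquivRealProd.symm q)
  rw [← this, ENNReal.ofReal_mul (gaussianPDFReal_nonneg _ _ _)]
  rfl

/-- The density of `CN(0, I_N)` with respect to Lebesgue measure. -/
noncomputable def noiseDensity (N : ℕ) (z : Fin N → ℂ) : ℝ := Real.pi⁻¹ ^ N * Real.exp (-sqNorm z)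

@[fun_prop]
lemma continuous_sqNorm (N : ℕ) : Continuous (sqNorm : (Fin N → ℂ) → ℝ) := by
  unfold sqNorm; fun_prop

lemma sqNorm_nonneg {N : ℕ} (z : Fin N → ℂ) : 0 ≤ sqNorm z :=
  Finset.sum_nonneg fun _ _ => sq_nonneg _

@[fun_prop]
lemma continuous_noiseDensity (N : ℕ) : Continuous (noiseDensity N) := by
  unfold noiseDensity; fun_prop

lemma noiseVec_eq_withDensity (N : ℕ) :
    noiseVec N = volume.withDensity fun z => ENNReal.ofReal (noiseDensity N z) := by
  rw [noiseVec, stdComplexGaussian_eq_withDensity,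
    pi_withDensity_ofReal _ (fun z => by positivity) integrable_exp_neg_norm_sq_complex]
  congr 1
  ext z
  rw [Finset.prod_mul_distrib, ← Real.exp_sum, Finset.prod_const, Finset.card_univ,
    Fintype.card_fin, noiseDensity, sqNorm, Finset.sum_neg_distrib]

lemma measurePreserving_re :
    MeasurePreserving Complex.re stdComplexGaussian (gaussianReal 0 (1 / 2)) := by
  refine ⟨Complex.measurable_re, ?_⟩
  rw [stdComplexGaussian, Measure.map_map Complex.measurable_re (MeasurableEquiv.measurable _)]
  exact measurePreserving_fst.map_eq

lemma measurePreserving_im :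
    MeasurePreserving Complex.im stdComplexGaussian (gaussianReal 0 (1 / 2)) := by
  refine ⟨Complex.measurable_im, ?_⟩
  rw [stdComplexGaussian, Measure.map_map Complex.measurable_im (MeasurableEquiv.measurable _)]
  exact measurePreserving_snd.map_eq

lemma memLp_sq_gaussianReal : MemLp (fun x : ℝ => x ^ 2) 2 (gaussianReal 0 (1 / 2)) := by
  have h : MemLp id 4 (gaussianReal 0 (1 / 2)) := memLp_id_gaussianReal' 4 (by simp)
  rw [memLp_two_iff_integrable_sq (by fun_prop)]
  have := h.integrable_norm_pow (p := 4) (by norm_num)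
  refine this.congr (Filter.Eventually.of_forall fun x => ?_)
  simp only [id, Real.norm_eq_abs]
  rw [show |x| ^ 4 = (|x| ^ 2) ^ 2 by ring, sq_abs]

lemma integral_sq_gaussianReal : ∫ x, x ^ 2 ∂gaussianReal 0 (1 / 2) = 1 / 2 := by
  have h := variance_fun_id_gaussianReal (μ := 0) (v := 1 / 2)
  rw [variance_of_integral_eq_zero (by fun_prop) integral_id_gaussianReal] at h
  simpa using h

lemma norm_sq_eq_re_add_im : (fun z : ℂ => ‖z‖ ^ 2) = fun z => z.re ^ 2 + z.im ^ 2 := by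
  ext z
  rw [← Complex.normSq_eq_norm_sq, Complex.normSq_apply]
  ring

lemma memLp_norm_sq_stdComplexGaussian :
    MemLp (fun z : ℂ => ‖z‖ ^ 2) 2 stdComplexGaussian := by
  rw [norm_sq_eq_re_add_im]
  exact (memLp_sq_gaussianReal.comp_measurePreserving measurePreserving_re).add
    (memLp_sq_gaussianReal.comp_measurePreserving measurePreserving_im)

lemma integral_norm_sq_stdComplexGaussian : ∫ z, ‖z‖ ^ 2 ∂stdComplexGaussian = 1 := by
  have hre := measurePreserving_re
  have him := measurePreserving_im
  have hi := memLp_sq_gaussianReal.integrable (by norm_num)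
  have hire : Integrable (fun z : ℂ => z.re ^ 2) stdComplexGaussian :=
    hre.integrable_comp_of_integrable hi
  have hiim : Integrable (fun z : ℂ => z.im ^ 2) stdComplexGaussian :=
    him.integrable_comp_of_integrable hi
  rw [norm_sq_eq_re_add_im, integral_add hire hiim]
  have h1 : ∫ z, z.re ^ 2 ∂stdComplexGaussian = 1 / 2 := by
    rw [← integral_sq_gaussianReal, ← hre.map_eq, integral_map hre.aemeasurable (by fun_prop)]
  have h2 : ∫ z, z.im ^ 2 ∂stdComplexGaussian = 1 / 2 := by
    rw [← integral_sq_gaussianReal, ← him.map_eq, integral_map him.aemeasurable (by fun_prop)]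
  rw [h1, h2]; norm_num

lemma memLp_sqNorm (N : ℕ) : MemLp sqNorm 2 (noiseVec N) := by
  have : (sqNorm : (Fin N → ℂ) → ℝ) = fun z => ∑ i, ‖z i‖ ^ 2 := rfl
  rw [this]
  exact memLp_finsetSum _ fun i _ => memLp_norm_sq_stdComplexGaussian.comp_measurePreserving
    (measurePreserving_eval (fun _ : Fin N => stdComplexGaussian) i)

lemma integrable_sqNorm (N : ℕ) : Integrable sqNorm (noiseVec N) :=
  (memLp_sqNorm N).integrable (by norm_num)

lemma integral_sqNorm (N : ℕ) : ∫ z, sqNorm z ∂noiseVec N = N := by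
  have hi (i : Fin N) := measurePreserving_eval (fun _ : Fin N => stdComplexGaussian) i
  have hint := memLp_norm_sq_stdComplexGaussian.integrable (by norm_num)
  have hi' (i : Fin N) : Integrable (fun z : Fin N → ℂ => ‖z i‖ ^ 2) (noiseVec N) :=
    (hi i).integrable_comp_of_integrable hint
  unfold sqNorm
  rw [integral_finsetSum _ fun i _ => hi' i]
  have (i : Fin N) : ∫ z, ‖z i‖ ^ 2 ∂noiseVec N = 1 := by
    rw [← integral_norm_sq_stdComplexGaussian, ← (hi i).map_eq,
      integral_map (hi i).aemeasurable (by fun_prop)]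
    rfl
  simp [this]

/-- The law of `a + z` has the translated density. -/
lemma map_add_noiseVec (N : ℕ) (a : Fin N → ℂ) :
    (noiseVec N).map (fun z => a + z) =
      volume.withDensity fun y => ENNReal.ofReal (noiseDensity N (y - a)) := by
  rw [noiseVec_eq_withDensity]
  ext s hs
  have hm : Measurable fun z : Fin N → ℂ => a + z := by fun_prop
  rw [Measure.map_apply hm hs, withDensity_apply _ (hm hs), withDensity_apply _ hs,
    ← (measurePreserving_add_left volume a).setLIntegral_comp_preimage hs (by fun_prop)]
  simp

/-! ### Degraded channels -/

/-- The characteristic function of `CN(0,1)`. -/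
lemma charFunDual_stdComplexGaussian (L : StrongDual ℝ ℂ) :
    charFunDual stdComplexGaussian L =
      Complex.exp (-((L 1 ^ 2 + L Complex.I ^ 2) / 4 : ℝ)) := by
  have hL (q : ℝ × ℝ) : L (Complex.measurableEquivRealProd.symm q) =
      q.1 * L 1 + q.2 * L Complex.I := by
    have : Complex.measurableEquivRealProd.symm q = q.1 • (1 : ℂ) + q.2 • Complex.I := by
      apply Complex.ext <;> simp [Complex.measurableEquivRealProd]
    rw [this, map_add, map_smul, map_smul, smul_eq_mul, smul_eq_mul]
  rw [charFunDual_apply, stdComplexGaussian, integral_map_equiv]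
  simp_rw [hL, Complex.ofReal_add, add_mul, Complex.exp_add]
  rw [integral_prod_mul (f := fun x : ℝ => Complex.exp (((x * L 1 : ℝ) : ℂ) * Complex.I))
    (g := fun x : ℝ => Complex.exp (((x * L Complex.I : ℝ) : ℂ) * Complex.I))]
  have key (t : ℝ) : ∫ x, Complex.exp (((x * t : ℝ) : ℂ) * Complex.I) ∂gaussianReal 0 (1 / 2) =
      Complex.exp (-(t ^ 2 / 4 : ℝ)) := by
    have h := charFun_gaussianReal (μ := 0) (v := 1 / 2) t
    rw [charFun_apply_real] at h
    convert h using 1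
    · refine integral_congr_ae (Filter.Eventually.of_forall fun x => ?_)
      simp [mul_comm]
    · push_cast; ring_nf
  rw [key, key, ← Complex.exp_add]
  congr 1
  push_cast
  ring

/-- The characteristic function of `CN(0, I_N)`, at the real functional `z ↦ Re ∑ tᵢ zᵢ`. -/
lemma charFunDual_noiseVec (N : ℕ) (t : Fin N → ℂ) (L : StrongDual ℝ (Fin N → ℂ))
    (hL : ∀ z, L z = (∑ i, t i * z i).re) :
    charFunDual (noiseVec N) L = Complex.exp (-(sqNorm t / 4 : ℝ)) := by
  classical
  rw [noiseVec, charFunDual_pi]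
  simp_rw [charFunDual_stdComplexGaussian]
  rw [← Complex.exp_sum]
  congr 1
  rw [Finset.sum_neg_distrib, ← Complex.ofReal_sum, ← Finset.sum_div, sqNorm]
  congr 3
  refine Finset.sum_congr rfl fun i _ => ?_
  have h1 (w : ℂ) : (L.comp (.single ℝ (fun _ : Fin N => ℂ) i)) w = (t i * w).re := by
    simp only [ContinuousLinearMap.coe_comp, Function.comp_apply, hL]
    congr 1
    simp [Pi.single_apply]
  rw [h1, h1, ← Complex.normSq_eq_norm_sq, Complex.normSq_apply]
  simp
  ring

lemma exists_re_sum_eq (N : ℕ) (L : StrongDual ℝ (Fin N → ℂ)) :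
    ∃ t : Fin N → ℂ, ∀ z, L z = (∑ i, t i * z i).re := by
  classical
  refine ⟨fun i => L (Pi.single i 1) - L (Pi.single i Complex.I) * Complex.I, fun z => ?_⟩
  have hz : z = ∑ i, ((z i).re • (Pi.single i 1 : Fin N → ℂ) +
      (z i).im • (Pi.single i Complex.I : Fin N → ℂ)) := by
    ext j
    simp [Finset.sum_apply, Pi.single_apply, Finset.sum_add_distrib]
  conv_lhs => rw [hz]
  simp only [map_sum, map_add, map_smul, smul_eq_mul, Complex.re_sum]
  refine Finset.sum_congr rfl fun i _ => ?_
  simp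
  ring

lemma sqNorm_mul_star {N : ℕ} (c : ℂ) (h : Fin N → ℂ) :
    sqNorm (fun j => c * star (h j)) = ‖c‖ ^ 2 * sqNorm h := by
  simp [sqNorm, mul_pow, Finset.mul_sum]

lemma sqNorm_sub_mul_star {N : ℕ} (t h : Fin N → ℂ) (c : ℝ) :
    sqNorm (fun j => t j - (c * ∑ i, t i * h i) * star (h j)) =
      sqNorm t - (2 * c - c ^ 2 * sqNorm h) * ‖∑ i, t i * h i‖ ^ 2 := by
  set τ := ∑ i, t i * h i with hτ
  have h1 : ∑ j, (t j * (starRingEnd ℂ) ((c * τ) * star (h j))).re = c * ‖τ‖ ^ 2 := by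
    have : ∀ j, t j * (starRingEnd ℂ) ((c * τ) * star (h j)) =
        (t j * h j) * (c * (starRingEnd ℂ) τ) := fun j => by
      simp; ring
    simp_rw [this]
    rw [← Complex.re_sum, ← Finset.sum_mul, ← hτ, mul_left_comm, Complex.mul_conj,
      ← Complex.ofReal_mul, Complex.ofReal_re, Complex.normSq_eq_norm_sq]
  clear_value τ
  have h2 := sqNorm_mul_star (c * τ) h
  have h3 : sqNorm (fun j => t j - (c * τ) * star (h j)) =
      sqNorm t + sqNorm (fun j => (c * τ) * star (h j)) -
        2 * ∑ j, (t j * (starRingEnd ℂ) ((c * τ) * star (h j))).re := by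
    simp only [sqNorm, ← Complex.normSq_eq_norm_sq, Complex.normSq_sub]
    rw [Finset.sum_sub_distrib, Finset.sum_add_distrib, Finset.mul_sum]
  rw [h3, h1, h2, norm_mul, mul_pow, Complex.norm_real, Real.norm_eq_abs, sq_abs]
  ring

/-- A channel vector `h'` that is not longer than `h` is a degraded version of it: some matrix `W`
maps `h` to `h'`, and adding to `W z` an independent Gaussian vector `V z'` restores white noise.
The matrix `W` has rank one, and `V` is a perturbation of the identity of rank one with
`W Wᴴ + V Vᴴ = I`. -/
lemma exists_degrading_map {N : ℕ} {h h' : Fin N → ℂ} (hs : sqNorm h ≠ 0)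
    (hle : sqNorm h' ≤ sqNorm h) :
    ∃ W V : (Fin N → ℂ) →L[ℂ] (Fin N → ℂ), W h = h' ∧
      ((noiseVec N).prod (noiseVec N)).map (fun q => W q.1 + V q.2) = noiseVec N := by
  have hs0 : 0 < sqNorm h := lt_of_le_of_ne (sqNorm_nonneg h) hs.symm
  set α : ℝ := (sqNorm h)⁻¹ with hα
  set r : ℝ := √(1 - sqNorm h' * α) with hr
  have hle1 : sqNorm h' * α ≤ 1 := by
    rw [hα, ← div_eq_mul_inv]; exact (div_le_one hs0).2 hle
  have hr0 : 0 ≤ r := Real.sqrt_nonneg _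
  have hr2 : r ^ 2 = 1 - sqNorm h' * α := Real.sq_sqrt (by linarith)
  -- `κ` solves `2 κ - κ² ‖h'‖² = α`, in a form that makes sense for `h' = 0` too.
  set κ : ℝ := α / (1 + r) with hκ
  have hκ2 : 2 * κ - κ ^ 2 * sqNorm h' = α := by
    have h1r : 1 + r ≠ 0 := by positivity
    rw [hκ]
    field_simp
    linear_combination (-1) * α * hr2
  let φ : (Fin N → ℂ) →L[ℂ] ℂ := ∑ j, (α * star (h j)) • ContinuousLinearMap.proj j
  let ψ : (Fin N → ℂ) →L[ℂ] ℂ := ∑ j, (κ * star (h' j)) • ContinuousLinearMap.proj j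
  have hφ (z) : φ z = ∑ j, (α * star (h j)) * z j := by simp [φ]
  have hψ (z) : ψ z = ∑ j, (κ * star (h' j)) * z j := by simp [ψ]
  let W : (Fin N → ℂ) →L[ℂ] (Fin N → ℂ) := φ.smulRight h'
  let V : (Fin N → ℂ) →L[ℂ] (Fin N → ℂ) := ContinuousLinearMap.id ℂ _ - ψ.smulRight h'
  have hW (z) : W z = φ z • h' := rfl
  have hV (z) : V z = z - ψ z • h' := rfl
  refine ⟨W, V, ?_, ?_⟩
  · have : φ h = 1 := by
      have h1 : ∑ j, (α * star (h j)) * h j = ((α * sqNorm h : ℝ) : ℂ) := by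
        rw [sqNorm, Finset.mul_sum, Complex.ofReal_sum]
        refine Finset.sum_congr rfl fun j _ => ?_
        rw [mul_assoc, Complex.star_def, Complex.conj_mul', Complex.ofReal_mul, Complex.ofReal_pow]
      rw [hφ, h1, hα, inv_mul_cancel₀ hs, Complex.ofReal_one]
    rw [hW, this, one_smul]
  let Q : (Fin N → ℂ) × (Fin N → ℂ) →L[ℝ] (Fin N → ℂ) :=
    (W.restrictScalars ℝ).coprod (V.restrictScalars ℝ)
  have hQ : (fun q : (Fin N → ℂ) × (Fin N → ℂ) => W q.1 + V q.2) = Q := by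
    ext q; simp [Q]
  rw [hQ]
  have : IsProbabilityMeasure (((noiseVec N).prod (noiseVec N)).map Q) :=
    Measure.isProbabilityMeasure_map (by fun_prop)
  refine Measure.ext_of_charFunDual (funext fun L => ?_)
  obtain ⟨t, ht⟩ := exists_re_sum_eq N L
  set τ := ∑ i, t i * h' i with hτ
  rw [charFunDual_map, charFunDual_prod, charFunDual_noiseVec N t L ht,
    charFunDual_noiseVec N (fun j => (α * τ) * star (h j)),
    charFunDual_noiseVec N (fun j => t j - (κ * τ) * star (h' j)), ← Complex.exp_add]
  · congr 1
    rw [sqNorm_mul_star, sqNorm_sub_mul_star, hκ2, ← hτ, norm_mul, mul_pow, Complex.norm_real,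
      Real.norm_eq_abs, sq_abs, ← Complex.ofReal_neg, ← Complex.ofReal_neg, ← Complex.ofReal_neg,
      ← Complex.ofReal_add]
    congr 1
    have : α ^ 2 * sqNorm h = α := by rw [hα]; field_simp
    linear_combination (-(‖τ‖ ^ 2) / 4) * this
  · intro z
    have : (L.comp Q).comp (.inr ℝ _ _) z = L (V z) := by simp [Q]
    rw [this, ht, hV]
    congr 1
    simp only [Pi.sub_apply, Pi.smul_apply, smul_eq_mul, mul_sub, sub_mul,
      Finset.sum_sub_distrib, hψ, hτ]
    congr 1
    simp only [Finset.mul_sum, Finset.sum_mul]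
    rw [Finset.sum_comm]
    refine Finset.sum_congr rfl fun i _ => Finset.sum_congr rfl fun j _ => ?_
    ring
  · intro z
    have : (L.comp Q).comp (.inl ℝ _ _) z = L (W z) := by simp [Q]
    rw [this, ht, hW]
    congr 1
    simp only [Pi.smul_apply, smul_eq_mul, hφ, hτ, Finset.mul_sum, Finset.sum_mul]
    rw [Finset.sum_comm]
    refine Finset.sum_congr rfl fun i _ => Finset.sum_congr rfl fun j _ => ?_
    ring

/-! ### The information density of the channel -/

section InfoDensity

variable {N : ℕ} {B : Finset ℂ}

/-- The density of the output `x h + z` for `x ~ p`, up to the normalizing factor `π^{-N}`. -/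
noncomputable def mixDensity (p : B → ℝ) (h : Fin N → ℂ) (y : Fin N → ℂ) : ℝ :=
  ∑ x' : B, p x' * Real.exp (-sqNorm (y - (x' : ℂ) • h))

/-- The information density, in nats, of the input `x` and the output `y`: the logarithm of the
ratio of the conditional density of `y` given `x` to the density of `y`. -/
noncomputable def infoDensity (p : B → ℝ) (h : Fin N → ℂ) (x : B) (y : Fin N → ℂ) : ℝ :=
  -sqNorm (y - (x : ℂ) • h) - Real.log (mixDensity p h y)

lemma fMaxSNR_eq_logb_mixDensity {K : ℕ} (H : Matrix (Fin N) (Fin K) ℂ) (g : Fin K → ℂ)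
    {A : Finset ℝ} (p : B → ℝ) (x : B) (θ : Fin K → A) (z : Fin N → ℂ) :
    fMaxSNR H g p x θ z =
      Real.logb 2 (mixDensity p (effChannel H g θ) ((x : ℂ) • effChannel H g θ + z)) := by
  rw [fMaxSNR, mixDensity]
  congr 2
  ext x'
  congr 4
  rw [sub_smul]
  abel

lemma mixDensity_pos {p : B → ℝ} (hp : p ∈ stdSimplex ℝ B) (h y : Fin N → ℂ) :
    0 < mixDensity p h y := by
  obtain ⟨x, hx⟩ : ∃ x, 0 < p x := by
    by_contra! hc
    have := Finset.sum_nonpos fun x (_ : x ∈ Finset.univ) => hc x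
    rw [hp.2] at this
    linarith
  exact Finset.sum_pos' (fun x' _ => mul_nonneg (hp.1 x') (Real.exp_pos _).le)
    ⟨x, Finset.mem_univ _, mul_pos hx (Real.exp_pos _)⟩

@[fun_prop]
lemma continuous_mixDensity (p : B → ℝ) (h : Fin N → ℂ) : Continuous (mixDensity p h) := by
  unfold mixDensity; fun_prop

@[fun_prop]
lemma measurable_infoDensity (p : B → ℝ) (h : Fin N → ℂ) (x : B) :
    Measurable (infoDensity p h x) := by
  unfold infoDensity
  exact (Continuous.measurable (by fun_prop)).sub
    ((continuous_mixDensity p h).measurable.log)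

lemma exp_infoDensity_mul_mixDensity {p : B → ℝ} (hp : p ∈ stdSimplex ℝ B) (h : Fin N → ℂ) (x : B)
    (y : Fin N → ℂ) :
    Real.exp (infoDensity p h x y) * mixDensity p h y = Real.exp (-sqNorm (y - (x : ℂ) • h)) := by
  have hm := mixDensity_pos hp h y
  rw [infoDensity, Real.exp_sub, Real.exp_log hm]
  field_simp

/-- For every output, the average over the inputs of the likelihood ratio is `1`. -/
lemma sum_mul_exp_infoDensity {p : B → ℝ} (hp : p ∈ stdSimplex ℝ B) (h y : Fin N → ℂ) :
    ∑ x, p x * Real.exp (infoDensity p h x y) = 1 := by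
  have hm := mixDensity_pos hp h y
  rw [← mul_left_inj' hm.ne', Finset.sum_mul, one_mul]
  conv_rhs => rw [mixDensity]
  exact Finset.sum_congr rfl fun x _ => by rw [mul_assoc, exp_infoDensity_mul_mixDensity hp]

lemma sqNorm_add_le (a b : Fin N → ℂ) : sqNorm (a + b) ≤ 2 * sqNorm a + 2 * sqNorm b := by
  simp only [sqNorm, Finset.mul_sum, ← Finset.sum_add_distrib]
  refine Finset.sum_le_sum fun i _ => ?_
  have h1 := norm_add_le (a i) (b i)
  have h2 : ‖a i + b i‖ ^ 2 ≤ (‖a i‖ + ‖b i‖) ^ 2 := by gcongr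
  rw [Pi.add_apply]
  nlinarith [sq_nonneg (‖a i‖ - ‖b i‖)]

/-- A bound on all the squared distances between noiseless channel outputs. -/
noncomputable def spread (B : Finset ℂ) (h : Fin N → ℂ) : ℝ :=
  ∑ x : B, ∑ x' : B, sqNorm (((x : ℂ) - (x' : ℂ)) • h)

lemma sqNorm_sub_smul_le_spread (h : Fin N → ℂ) (x x' : B) :
    sqNorm (((x : ℂ) - (x' : ℂ)) • h) ≤ spread B h :=
  (Finset.single_le_sum (f := fun x' : B => sqNorm (((x : ℂ) - (x' : ℂ)) • h))
    (fun _ _ => sqNorm_nonneg _) (Finset.mem_univ x')).trans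
  (Finset.single_le_sum (f := fun x : B => ∑ x' : B, sqNorm (((x : ℂ) - (x' : ℂ)) • h))
    (fun _ _ => Finset.sum_nonneg fun _ _ => sqNorm_nonneg _) (Finset.mem_univ x))

/-- The bound is uniform in the input distribution `p`. -/
lemma abs_log_mixDensity_le {p : B → ℝ} (hp : p ∈ stdSimplex ℝ B) (h : Fin N → ℂ) (x : B)
    (z : Fin N → ℂ) :
    |Real.log (mixDensity p h ((x : ℂ) • h + z))| ≤ 2 * sqNorm z + 2 * spread B h := by
  have hm := mixDensity_pos hp h ((x : ℂ) • h + z)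
  have hupper : mixDensity p h ((x : ℂ) • h + z) ≤ 1 := by
    rw [← hp.2]
    refine Finset.sum_le_sum fun x' _ => mul_le_of_le_one_right (hp.1 x') ?_
    exact Real.exp_le_one_iff.2 (neg_nonpos.2 (sqNorm_nonneg _))
  have hlower : Real.exp (-(2 * sqNorm z + 2 * spread B h)) ≤
      mixDensity p h ((x : ℂ) • h + z) := by
    rw [← one_mul (Real.exp _), ← hp.2, Finset.sum_mul]
    refine Finset.sum_le_sum fun x' _ => mul_le_mul_of_nonneg_left ?_ (hp.1 x')
    rw [Real.exp_le_exp, neg_le_neg_iff]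
    have h1 : (x : ℂ) • h + z - (x' : ℂ) • h = z + ((x : ℂ) - (x' : ℂ)) • h := by
      rw [sub_smul]; abel
    rw [h1]
    have h2 := sqNorm_sub_smul_le_spread h x x'
    have h3 := sqNorm_add_le z (((x : ℂ) - (x' : ℂ)) • h)
    linarith
  have hlog := (Real.le_log_iff_exp_le hm).2 hlower
  have hlog0 := Real.log_nonpos hm.le hupper
  rw [abs_le]
  constructor <;> linarith [sqNorm_nonneg z, Finset.sum_nonneg
    fun x (_ : x ∈ (Finset.univ : Finset B)) => Finset.sum_nonneg
      fun x' (_ : x' ∈ (Finset.univ : Finset B)) => sqNorm_nonneg (((x : ℂ) - (x' : ℂ)) • h)]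

lemma memLp_log_mixDensity {p : B → ℝ} (hp : p ∈ stdSimplex ℝ B) (h : Fin N → ℂ) (x : B) :
    MemLp (fun z => Real.log (mixDensity p h ((x : ℂ) • h + z))) 2 (noiseVec N) := by
  have hb : MemLp (fun z => 2 * sqNorm z + 2 * spread B h) 2 (noiseVec N) :=
    ((memLp_sqNorm N).const_mul 2).add (memLp_const _)
  refine hb.mono' ?_ (Filter.Eventually.of_forall fun z => ?_)
  · exact ((Continuous.measurable (by fun_prop)).log).aestronglyMeasurable
  · exact abs_log_mixDensity_le hp h x z

lemma integrable_log_mixDensity {p : B → ℝ} (hp : p ∈ stdSimplex ℝ B) (h : Fin N → ℂ) (x : B) :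
    Integrable (fun z => Real.log (mixDensity p h ((x : ℂ) • h + z))) (noiseVec N) :=
  (memLp_log_mixDensity hp h x).integrable (by norm_num)

lemma infoDensity_smul_add (p : B → ℝ) (h : Fin N → ℂ) (x : B) (z : Fin N → ℂ) :
    infoDensity p h x ((x : ℂ) • h + z) =
      -sqNorm z - Real.log (mixDensity p h ((x : ℂ) • h + z)) := by
  rw [infoDensity, add_sub_cancel_left]

lemma memLp_infoDensity {p : B → ℝ} (hp : p ∈ stdSimplex ℝ B) (h : Fin N → ℂ) (x : B) :
    MemLp (fun z => infoDensity p h x ((x : ℂ) • h + z)) 2 (noiseVec N) := by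
  simp_rw [infoDensity_smul_add]
  exact (memLp_sqNorm N).neg.sub (memLp_log_mixDensity hp h x)

lemma integrable_infoDensity {p : B → ℝ} (hp : p ∈ stdSimplex ℝ B) (h : Fin N → ℂ) (x : B) :
    Integrable (fun z => infoDensity p h x ((x : ℂ) • h + z)) (noiseVec N) :=
  (memLp_infoDensity hp h x).integrable (by norm_num)

/-- The mean of the information density, for `x ~ p` and `y = x h + z`. -/
noncomputable def meanInfo (p : B → ℝ) (h : Fin N → ℂ) : ℝ :=
  ∑ x, p x * ∫ z, infoDensity p h x ((x : ℂ) • h + z) ∂noiseVec N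

/-- The conditional entropy contributes the expectation `N` of `‖z‖²`. -/
lemma meanInfo_eq {p : B → ℝ} (hp : p ∈ stdSimplex ℝ B) (h : Fin N → ℂ) :
    meanInfo p h = -N -
      ∑ x, p x * ∫ z, Real.log (mixDensity p h ((x : ℂ) • h + z)) ∂noiseVec N := by
  have h1 (x : B) : ∫ z, infoDensity p h x ((x : ℂ) • h + z) ∂noiseVec N =
      -N - ∫ z, Real.log (mixDensity p h ((x : ℂ) • h + z)) ∂noiseVec N := by
    simp_rw [infoDensity_smul_add]
    have hi : Integrable (fun z => -sqNorm z) (noiseVec N) := (integrable_sqNorm N).neg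
    rw [integral_sub hi (integrable_log_mixDensity hp h x), integral_neg, integral_sqNorm]
  rw [meanInfo]
  simp_rw [h1, mul_sub]
  rw [Finset.sum_sub_distrib, ← Finset.sum_mul, hp.2, one_mul]

lemma objective_eq {K : ℕ} (H : Matrix (Fin N) (Fin K) ℂ) (g : Fin K → ℂ)
    {A : Finset ℝ} {p : B → ℝ} (hp : p ∈ stdSimplex ℝ B) (θ : Fin K → A) :
    objective H g p θ = (-N - meanInfo p (effChannel H g θ)) / Real.log 2 := by
  rw [meanInfo_eq hp, objective]
  simp_rw [fMaxSNR_eq_logb_mixDensity, Real.logb, integral_div]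
  rw [sub_sub_cancel, Finset.sum_div]
  exact Finset.sum_congr rfl fun x _ => by rw [mul_div_assoc]

/-! ### Mutual information -/

/-- The joint law of `(x, x h + z)`. -/
noncomputable def channelLaw (p : B → ℝ) (h : Fin N → ℂ) : Measure (B × (Fin N → ℂ)) :=
  ∑ x : B, ENNReal.ofReal (p x) • (Measure.dirac x).prod
    ((noiseVec N).map fun z => (x : ℂ) • h + z)

instance (a : Fin N → ℂ) : IsProbabilityMeasure ((noiseVec N).map fun z => a + z) :=
  Measure.isProbabilityMeasure_map (by fun_prop)

lemma lintegral_sum_dirac_prod {Y : Type*} [MeasurableSpace Y] (w : B → ENNReal)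
    (κ : B → Measure Y) [∀ x, SFinite (κ x)] {f : B × Y → ENNReal} (hf : Measurable f) :
    ∫⁻ q, f q ∂(∑ x, w x • (Measure.dirac x).prod (κ x)) = ∑ x, w x * ∫⁻ y, f (x, y) ∂κ x := by
  rw [lintegral_finsetSum_measure]
  refine Finset.sum_congr rfl fun x _ => ?_
  rw [lintegral_smul_measure, Measure.dirac_prod, lintegral_map hf (by fun_prop), smul_eq_mul]

lemma sum_ofReal_eq_one {p : B → ℝ} (hp : p ∈ stdSimplex ℝ B) :
    ∑ x, ENNReal.ofReal (p x) = 1 := by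
  rw [← ENNReal.ofReal_sum_of_nonneg fun x _ => hp.1 x, hp.2, ENNReal.ofReal_one]

lemma isProbabilityMeasure_channelLaw {p : B → ℝ} (hp : p ∈ stdSimplex ℝ B) (h : Fin N → ℂ) :
    IsProbabilityMeasure (channelLaw p h) := by
  constructor
  simp only [channelLaw, Measure.coe_finsetSum, Finset.sum_apply, Measure.smul_apply, measure_univ,
    smul_eq_mul, mul_one]
  exact sum_ofReal_eq_one hp

lemma fst_channelLaw (p : B → ℝ) (h : Fin N → ℂ) :
    (channelLaw p h).fst = ∑ x, ENNReal.ofReal (p x) • Measure.dirac x := by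
  ext s hs
  rw [Measure.fst_apply hs, ← Set.prod_univ]
  simp only [channelLaw, Measure.coe_finsetSum, Finset.sum_apply, Measure.smul_apply,
    Measure.prod_prod, measure_univ, mul_one]

lemma snd_channelLaw {p : B → ℝ} (hp : p ∈ stdSimplex ℝ B) (h : Fin N → ℂ) :
    (channelLaw p h).snd =
      volume.withDensity fun y => ENNReal.ofReal (Real.pi⁻¹ ^ N * mixDensity p h y) := by
  ext s hs
  rw [Measure.snd_apply hs, ← Set.univ_prod, withDensity_apply _ hs]
  simp only [channelLaw, Measure.coe_finsetSum, Finset.sum_apply, Measure.smul_apply,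
    Measure.prod_prod, measure_univ, one_mul, map_add_noiseVec, withDensity_apply _ hs, smul_eq_mul]
  simp_rw [← lintegral_const_mul' _ _ ENNReal.ofReal_ne_top]
  rw [← lintegral_finsetSum _ fun x _ => by fun_prop]
  refine lintegral_congr fun y => ?_
  rw [mixDensity, Finset.mul_sum, ENNReal.ofReal_sum_of_nonneg fun x _ => mul_nonneg (by positivity)
    (mul_nonneg (hp.1 x) (Real.exp_pos _).le)]
  refine Finset.sum_congr rfl fun x _ => ?_
  rw [← ENNReal.ofReal_mul (hp.1 x), noiseDensity]
  ring_nf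

@[fun_prop]
lemma measurable_infoDensity_uncurry (p : B → ℝ) (h : Fin N → ℂ) :
    Measurable fun q : B × (Fin N → ℂ) => infoDensity p h q.1 q.2 :=
  measurable_from_prod_countable_right fun x => measurable_infoDensity p h x

/-- The information density is the logarithm of the density of the joint law with respect to the
product of its marginals. -/
lemma channelLaw_eq_withDensity {p : B → ℝ} (hp : p ∈ stdSimplex ℝ B) (h : Fin N → ℂ) :
    channelLaw p h = ((channelLaw p h).fst.prod (channelLaw p h).snd).withDensity
      fun q => ENNReal.ofReal (Real.exp (infoDensity p h q.1 q.2)) := by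
  have := isProbabilityMeasure_channelLaw hp h
  have hprod : (channelLaw p h).fst.prod (channelLaw p h).snd =
      ∑ x, ENNReal.ofReal (p x) • (Measure.dirac x).prod (channelLaw p h).snd := by
    rw [fst_channelLaw]
    ext s hs
    rw [Measure.prod_apply hs, lintegral_finsetSum_measure]
    simp only [Measure.coe_finsetSum, Finset.sum_apply, Measure.smul_apply, Measure.prod_apply hs,
      lintegral_smul_measure]
  ext s hs
  have hmeas : Measurable fun q : B × (Fin N → ℂ) =>
      ENNReal.ofReal (Real.exp (infoDensity p h q.1 q.2)) := by fun_prop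
  rw [withDensity_apply _ hs, ← lintegral_indicator hs, hprod,
    lintegral_sum_dirac_prod _ _ (hmeas.indicator hs), ← lintegral_indicator_one hs]
  conv_lhs => rw [channelLaw]
  rw [lintegral_sum_dirac_prod _ _ (measurable_one.indicator hs)]
  refine Finset.sum_congr rfl fun x _ => ?_
  congr 1
  have h1 : Measurable fun y => s.indicator (1 : B × (Fin N → ℂ) → ENNReal) (x, y) :=
    (measurable_one.indicator hs).comp measurable_prodMk_left
  have h2 : Measurable fun y => s.indicator
      (fun q => ENNReal.ofReal (Real.exp (infoDensity p h q.1 q.2))) (x, y) :=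
    (hmeas.indicator hs).comp measurable_prodMk_left
  rw [snd_channelLaw hp, map_add_noiseVec,
    lintegral_withDensity_eq_lintegral_mul _ (by fun_prop) h1,
    lintegral_withDensity_eq_lintegral_mul _ (by fun_prop) h2]
  refine lintegral_congr fun y => ?_
  simp only [Pi.mul_apply, Set.indicator]
  split_ifs with hy
  · rw [Pi.one_apply, mul_one, ← ENNReal.ofReal_mul (mul_nonneg (by positivity)
      (mixDensity_pos hp h y).le), noiseDensity, ← exp_infoDensity_mul_mixDensity hp h x y]
    ring_nf
  · simp

/-- The mutual information is finite, and it is the mean of the information density. -/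
lemma mutualInfo_channelLaw {p : B → ℝ} (hp : p ∈ stdSimplex ℝ B) (h : Fin N → ℂ) :
    mutualInfo (channelLaw p h) ≠ ⊤ ∧ (mutualInfo (channelLaw p h)).toReal = meanInfo p h := by
  have := isProbabilityMeasure_channelLaw hp h
  set ρ := (channelLaw p h).fst.prod (channelLaw p h).snd with hρ
  have hμ := channelLaw_eq_withDensity hp h
  rw [← hρ] at hμ
  have hac : channelLaw p h ≪ ρ := by
    rw [hμ]; exact withDensity_absolutelyContinuous _ _
  have hllr : llr (channelLaw p h) ρ =ᵐ[channelLaw p h] fun q => infoDensity p h q.1 q.2 := by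
    have h1 : (channelLaw p h).rnDeriv ρ =ᵐ[ρ]
        fun q => ENNReal.ofReal (Real.exp (infoDensity p h q.1 q.2)) := by
      conv_lhs => rw [hμ]
      exact Measure.rnDeriv_withDensity _ (by fun_prop)
    filter_upwards [hac.ae_le h1] with q hq
    rw [llr, hq, ENNReal.toReal_ofReal (Real.exp_pos _).le, Real.log_exp]
  have hmap (x : B) : (Measure.dirac x).prod ((noiseVec N).map fun z => (x : ℂ) • h + z) =
      (noiseVec N).map fun z => (x, (x : ℂ) • h + z) := by
    rw [Measure.dirac_prod, Measure.map_map (by fun_prop) (by fun_prop)]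
    rfl
  have hint (x : B) : Integrable (fun q : B × (Fin N → ℂ) => infoDensity p h q.1 q.2)
      (ENNReal.ofReal (p x) • (Measure.dirac x).prod
        ((noiseVec N).map fun z => (x : ℂ) • h + z)) := by
    refine Integrable.smul_measure ?_ ENNReal.ofReal_ne_top
    rw [hmap, integrable_map_measure (Measurable.aestronglyMeasurable (by fun_prop)) (by fun_prop)]
    exact integrable_infoDensity hp h x
  have hint' : Integrable (fun q => infoDensity p h q.1 q.2) (channelLaw p h) := by
    rw [channelLaw, integrable_finsetSum_measure]
    exact fun x _ => hint x
  refine ⟨InformationTheory.klDiv_ne_top hac (hint'.congr hllr.symm), ?_⟩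
  rw [mutualInfo, InformationTheory.toReal_klDiv_of_measure_eq hac (by simp),
    integral_congr_ae hllr, channelLaw, integral_finsetSum_measure fun x _ => hint x, meanInfo]
  refine Finset.sum_congr rfl fun x _ => ?_
  rw [integral_smul_measure, ENNReal.toReal_ofReal (hp.1 x), hmap, integral_map (by fun_prop)
    (Measurable.aestronglyMeasurable (by fun_prop)), smul_eq_mul]

/-! ### Monotonicity in the signal-to-noise ratio -/

lemma lintegral_channelLaw (p : B → ℝ) (h : Fin N → ℂ) {f : B × (Fin N → ℂ) → ENNReal}
    (hf : Measurable f) :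
    ∫⁻ q, f q ∂channelLaw p h =
      ∑ x, ENNReal.ofReal (p x) * ∫⁻ z, f (x, (x : ℂ) • h + z) ∂noiseVec N := by
  rw [channelLaw, lintegral_sum_dirac_prod _ _ hf]
  refine Finset.sum_congr rfl fun x _ => ?_
  have hfx : Measurable fun y => f (x, y) := hf.comp measurable_prodMk_left
  rw [lintegral_map hfx (by fun_prop)]

/-- Data processing: a function of the output and of independent randomness has no more
information about the input than the output itself. -/
lemma mutualInfo_map_le {α β γ δ : Type*} [MeasurableSpace α] [MeasurableSpace β]
    [MeasurableSpace γ] [MeasurableSpace δ] (μ : Measure (α × β)) [IsProbabilityMeasure μ]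
    (ν : Measure γ) [IsProbabilityMeasure ν] {ψ : β × γ → δ} (hψ : Measurable ψ) :
    mutualInfo ((μ.prod ν).map fun q => (q.1.1, ψ (q.1.2, q.2))) ≤ mutualInfo μ := by
  set G : (α × β) × γ → α × δ := fun q => (q.1.1, ψ (q.1.2, q.2)) with hG
  have hGm : Measurable G := by fun_prop
  have hfst : ((μ.prod ν).map G).fst = μ.fst := by
    rw [Measure.fst, Measure.map_map measurable_fst hGm, Measure.fst]
    have : Prod.fst ∘ G = Prod.fst ∘ Prod.fst := rfl
    rw [this, ← Measure.map_map measurable_fst measurable_fst, measurePreserving_fst.map_eq]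
  have hsnd : ((μ.prod ν).map G).snd = (μ.snd.prod ν).map ψ := by
    rw [Measure.snd, Measure.map_map measurable_snd hGm, Measure.snd]
    have h1 : (μ.map Prod.snd).prod ν = (μ.prod ν).map (Prod.map Prod.snd id) := by
      rw [← Measure.map_prod_map _ _ measurable_snd measurable_id, Measure.map_id]
    rw [h1, Measure.map_map hψ (by fun_prop)]
    rfl
  have hprod : ((μ.prod ν).map G).fst.prod ((μ.prod ν).map G).snd =
      ((μ.fst.prod μ.snd).prod ν).map G := by
    rw [hfst, hsnd]
    have h2 : G = Prod.map id ψ ∘ MeasurableEquiv.prodAssoc := rfl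
    rw [h2, ← Measure.map_map (by fun_prop) (by fun_prop), Measure.prodAssoc_prod,
      ← Measure.map_prod_map _ _ measurable_id hψ, Measure.map_id]
  rw [mutualInfo, hprod, mutualInfo]
  refine (InformationTheory.klDiv_map_le _ _ hGm).trans_eq ?_
  rw [← Measure.compProd_const, ← Measure.compProd_const, InformationTheory.klDiv_compProd_left]

/-- A longer channel vector conveys at least as much information, since the shorter one is a
degraded version of it. -/
lemma meanInfo_mono {p : B → ℝ} (hp : p ∈ stdSimplex ℝ B) {h h' : Fin N → ℂ}
    (hle : sqNorm h' ≤ sqNorm h) : meanInfo p h' ≤ meanInfo p h := by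
  rcases eq_or_ne (sqNorm h) 0 with hs | hs
  · have hzero : ∀ {v : Fin N → ℂ}, sqNorm v ≤ 0 → v = 0 := fun {v} hv => by
      ext i
      have := (Finset.sum_eq_zero_iff_of_nonneg fun i _ => sq_nonneg ‖v i‖).1
        (le_antisymm hv (sqNorm_nonneg v)) i (Finset.mem_univ i)
      simpa using this
    rw [hzero hs.le, hzero (hle.trans hs.le)]
  obtain ⟨W, V, hW, hWV⟩ := exists_degrading_map hs hle
  have := isProbabilityMeasure_channelLaw hp h
  have key : channelLaw p h' = ((channelLaw p h).prod (noiseVec N)).map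
      fun q => (q.1.1, W q.1.2 + V q.2) := by
    ext s hs
    have hf : Measurable (s.indicator (1 : B × (Fin N → ℂ) → ENNReal)) :=
      measurable_one.indicator hs
    have hG : Measurable fun q : (B × (Fin N → ℂ)) × (Fin N → ℂ) =>
        (q.1.1, W q.1.2 + V q.2) := by fun_prop
    have hfG : Measurable fun q : (B × (Fin N → ℂ)) × (Fin N → ℂ) =>
        s.indicator (1 : B × (Fin N → ℂ) → ENNReal) (q.1.1, W q.1.2 + V q.2) := hf.comp hG
    rw [← lintegral_indicator_one hs, ← lintegral_indicator_one hs, lintegral_map hf hG,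
      lintegral_prod _ hfG.aemeasurable, lintegral_channelLaw _ _ hf,
      lintegral_channelLaw _ _ hfG.lintegral_prod_right']
    refine Finset.sum_congr rfl fun x _ => ?_
    congr 1
    have hF : Measurable fun z => s.indicator (1 : B × (Fin N → ℂ) → ENNReal)
        (x, (x : ℂ) • h' + z) := hf.comp (by fun_prop)
    have hFm : Measurable fun q : (Fin N → ℂ) × (Fin N → ℂ) =>
        s.indicator (1 : B × (Fin N → ℂ) → ENNReal) (x, (x : ℂ) • h' + (W q.1 + V q.2)) :=
      hF.comp (g := fun z => _) (by fun_prop)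
    conv_lhs => rw [← hWV]
    rw [lintegral_map hF (by fun_prop), lintegral_prod _ hFm.aemeasurable]
    refine lintegral_congr fun z => lintegral_congr fun z' => ?_
    rw [map_add, map_smul, hW, add_assoc]
  rw [← (mutualInfo_channelLaw hp h').2, ← (mutualInfo_channelLaw hp h).2]
  refine ENNReal.toReal_mono (mutualInfo_channelLaw hp h).1 ?_
  rw [key]
  exact mutualInfo_map_le (channelLaw p h) (noiseVec N) (ψ := fun q => W q.1 + V q.2) (by fun_prop)

/-! ### Optimal input distributions -/

lemma continuousOn_meanInfo (h : Fin N → ℂ) :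
    ContinuousOn (fun p : B → ℝ => meanInfo p h) (stdSimplex ℝ B) := by
  unfold meanInfo
  refine continuousOn_finsetSum _ fun x _ => ContinuousOn.mul (by fun_prop) ?_
  refine continuousOn_of_dominated (bound := fun z => sqNorm z + (2 * sqNorm z + 2 * spread B h))
    (fun p _ => ?_) (fun p hp => ?_) ?_ ?_
  · exact Measurable.aestronglyMeasurable (by fun_prop)
  · refine Filter.Eventually.of_forall fun z => ?_
    rw [infoDensity_smul_add, Real.norm_eq_abs]
    refine (abs_sub _ _).trans (add_le_add ?_ (abs_log_mixDensity_le hp h x z))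
    rw [abs_neg, abs_of_nonneg (sqNorm_nonneg z)]
  · exact (integrable_sqNorm N).add (((integrable_sqNorm N).const_mul 2).add (integrable_const _))
  · refine Filter.Eventually.of_forall fun z => ?_
    unfold infoDensity
    refine continuousOn_const.sub (ContinuousOn.log ?_ fun p hp => (mixDensity_pos hp h _).ne')
    unfold mixDensity
    fun_prop

lemma isCompact_setOf_isFeasible (P : ℝ) : IsCompact {p : B → ℝ | IsFeasible P p} := by
  have : {p : B → ℝ | IsFeasible P p} =
      stdSimplex ℝ B ∩ {p | ∑ x : B, p x * ‖(x : ℂ)‖ ^ 2 ≤ P} := rfl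
  rw [this]
  exact (isCompact_stdSimplex ℝ B).inter_right (isClosed_le (by fun_prop) continuous_const)

/-- Some feasible input distribution maximizes the information for the channel vector `h`. -/
lemma exists_isFeasible_meanInfo_max {P : ℝ} (hB : ∃ p : B → ℝ, IsFeasible P p)
    (h : Fin N → ℂ) :
    ∃ p : B → ℝ, IsFeasible P p ∧ ∀ p' : B → ℝ, IsFeasible P p' → meanInfo p' h ≤ meanInfo p h := by
  obtain ⟨p, hp, hmax⟩ := (isCompact_setOf_isFeasible P).exists_isMaxOn hB
    ((continuousOn_meanInfo h).mono fun p hp => hp.1)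
  exact ⟨p, hp, fun p' hp' => hmax hp'⟩

end InfoDensity

/-! ### Random coding with a threshold decoder -/

section ThresholdDecoder

variable {Y : Type*} {M : ℕ}

lemma exists_forall_lt_imp (S : Fin M → Y → Prop) (y : Y) : ∃ k : ℕ, ∀ hk : k < M, S ⟨k, hk⟩ y :=
  ⟨M, fun hk => absurd hk (lt_irrefl M)⟩

open Classical in
/-- The decoder that returns the first message `w` passing the test `S w y`, and `0` if there is
none. -/
noncomputable def firstPassing [NeZero M] (S : Fin M → Y → Prop) (y : Y) : Fin M :=
  if hk : Nat.find (exists_forall_lt_imp S y) < M then ⟨_, hk⟩ else 0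

lemma measurable_firstPassing [NeZero M] [MeasurableSpace Y] {S : Fin M → Y → Prop}
    (hS : ∀ w, MeasurableSet {y | S w y}) : Measurable (firstPassing S) := by
  classical
  have hfind : Measurable fun y => Nat.find (exists_forall_lt_imp S y) := by
    refine measurable_find _ fun k => ?_
    by_cases hk : k < M
    · simpa [hk] using hS ⟨k, hk⟩
    · simp [hk]
  exact (Measurable.of_discrete
    (f := fun k : ℕ => if hk : k < M then ⟨k, hk⟩ else (0 : Fin M))).comp hfind

lemma firstPassing_eq [NeZero M] {S : Fin M → Y → Prop} {y : Y} {w : Fin M} (hw : S w y)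
    (hw' : ∀ w' ≠ w, ¬ S w' y) : firstPassing S y = w := by
  classical
  have hfind : Nat.find (exists_forall_lt_imp S y) = w := by
    refine (Nat.find_eq_iff _).2 ⟨fun _ => hw, fun k hk hSk => ?_⟩
    exact hw' ⟨k, hk.trans w.2⟩ (by simp [Fin.ext_iff, hk.ne]) (hSk _)
  have hlt : Nat.find (exists_forall_lt_imp S y) < M := hfind ▸ w.2
  rw [firstPassing, dif_pos hlt]
  exact Fin.ext hfind

end ThresholdDecoder

section RandomCoding

/-- Distinct codewords of a random codebook are independent. -/
lemma map_pair_pi {ι X : Type*} [Fintype ι] [MeasurableSpace X] (μ : Measure X)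
    [IsProbabilityMeasure μ] {w w' : ι} (hne : w ≠ w') :
    (Measure.pi fun _ : ι => μ).map (fun c => (c w, c w')) = μ.prod μ := by
  have hind := (iIndepFun_pi (μ := fun _ : ι => μ) (X := fun _ => id)
    fun _ => aemeasurable_id).indepFun hne
  have := (indepFun_iff_map_prod_eq_prod_map_map
    (measurable_pi_apply w).aemeasurable
    (measurable_pi_apply w').aemeasurable).1 hind
  have h1 (v : ι) : (Measure.pi fun _ : ι => μ).map (fun c => c v) = μ :=
    (measurePreserving_eval (fun _ : ι => μ) v).map_eq
  rw [h1, h1] at this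
  exact this

variable {X Ω Y : Type*} [Finite X] [MeasurableSpace X] [MeasurableSingletonClass X]
  [MeasurableSpace Ω] [MeasurableSpace Y]

/-- Bound on the probability that the threshold decoder errs, averaged over random codebooks with
independent codewords: either the transmitted codeword fails its test, or one of the other
codewords, which are independent of the output, passes it. -/
lemma lintegral_sum_error_le {M : ℕ} [NeZero M] (μ : Measure X) [IsProbabilityMeasure μ]
    (ν : Measure Ω) [IsProbabilityMeasure ν] {recv : X → Ω → Y} (hrecv : ∀ x, Measurable (recv x))
    {S : X → Y → Prop} (hS : ∀ x, MeasurableSet {y | S x y}) {e η : ENNReal}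
    (he : ∀ y, μ {x | S x y} ≤ e) (hη : ∫⁻ x, ν {ω | ¬ S x (recv x ω)} ∂μ ≤ η) :
    ∫⁻ c : Fin M → X, (∑ w, ν {ω | firstPassing (fun w => S (c w)) (recv (c w) ω) ≠ w})
      ∂(Measure.pi fun _ => μ) ≤ M * (η + M * e) := by
  classical
  have hbound (c : Fin M → X) (w : Fin M) :
      ν {ω | firstPassing (fun w => S (c w)) (recv (c w) ω) ≠ w} ≤
        ν {ω | ¬ S (c w) (recv (c w) ω)} +
          ∑ w' ∈ Finset.univ.erase w, ν {ω | S (c w') (recv (c w) ω)} := by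
    have hsub : {ω | firstPassing (fun w => S (c w)) (recv (c w) ω) ≠ w} ⊆
        {ω | ¬ S (c w) (recv (c w) ω)} ∪
          ⋃ w' ∈ Finset.univ.erase w, {ω | S (c w') (recv (c w) ω)} := by
      intro ω hω
      by_contra hcon
      simp only [Set.mem_union, Set.mem_iUnion, Set.mem_ofPred_eq, not_or, not_not, not_exists,
        Finset.mem_erase, Finset.mem_univ, and_true] at hcon
      exact hω (firstPassing_eq (S := fun w => S (c w)) hcon.1 hcon.2)
    refine (measure_mono hsub).trans ((measure_union_le _ _).trans ?_)
    gcongr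
    exact measure_biUnion_finset_le _ _
  have hfirst (w : Fin M) : ∫⁻ c : Fin M → X, ν {ω | ¬ S (c w) (recv (c w) ω)}
      ∂(Measure.pi fun _ => μ) ≤ η := by
    refine le_trans (le_of_eq ?_) hη
    rw [← (measurePreserving_eval (fun _ : Fin M => μ) w).lintegral_comp
      (f := fun x => ν {ω | ¬ S x (recv x ω)}) Measurable.of_discrete]
  have hsecond (w w' : Fin M) (hne : w' ≠ w) :
      ∫⁻ c : Fin M → X, ν {ω | S (c w') (recv (c w) ω)} ∂(Measure.pi fun _ => μ) ≤ e := by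
    have h1 : ∫⁻ c : Fin M → X, ν {ω | S (c w') (recv (c w) ω)} ∂(Measure.pi fun _ => μ) =
        ∫⁻ x, ∫⁻ x', ν {ω | S x' (recv x ω)} ∂μ ∂μ := by
      rw [← lintegral_prod (fun q : X × X => ν {ω | S q.2 (recv q.1 ω)})
        Measurable.of_discrete.aemeasurable, ← map_pair_pi μ hne.symm,
        lintegral_map Measurable.of_discrete (by fun_prop)]
    rw [h1]
    have h2 (x : X) : ∫⁻ x', ν {ω | S x' (recv x ω)} ∂μ ≤ e := by
      have hm : MeasurableSet {q : X × Ω | S q.1 (recv x q.2)} := by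
        have : {q : X × Ω | S q.1 (recv x q.2)} =
            ⋃ x' : X, {x'} ×ˢ {ω | S x' (recv x ω)} := by
          ext q; simp
        rw [this]
        have : Countable X := Finite.to_countable
        exact MeasurableSet.iUnion fun x' => (measurableSet_singleton x').prod (hrecv x (hS x'))
      have h3 : (μ.prod ν) {q : X × Ω | S q.1 (recv x q.2)} ≤ e := by
        rw [Measure.prod_apply_symm hm]
        calc ∫⁻ ω, μ ((fun x' => (x', ω)) ⁻¹' {q : X × Ω | S q.1 (recv x q.2)}) ∂ν
            ≤ ∫⁻ _, e ∂ν := lintegral_mono fun ω => he (recv x ω)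
          _ = e := by simp
      rw [Measure.prod_apply hm] at h3
      exact h3
    calc ∫⁻ x, ∫⁻ x', ν {ω | S x' (recv x ω)} ∂μ ∂μ ≤ ∫⁻ _, e ∂μ := lintegral_mono h2
      _ = e := by simp
  calc _ ≤ ∫⁻ c : Fin M → X, (∑ w, (ν {ω | ¬ S (c w) (recv (c w) ω)} +
          ∑ w' ∈ Finset.univ.erase w, ν {ω | S (c w') (recv (c w) ω)})) ∂(Measure.pi fun _ => μ) :=
        lintegral_mono fun c => Finset.sum_le_sum fun w _ => hbound c w
    _ = ∑ w, (∫⁻ c : Fin M → X, ν {ω | ¬ S (c w) (recv (c w) ω)} ∂(Measure.pi fun _ => μ) +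
          ∑ w' ∈ Finset.univ.erase w,
            ∫⁻ c : Fin M → X, ν {ω | S (c w') (recv (c w) ω)} ∂(Measure.pi fun _ => μ)) := by
        rw [lintegral_finsetSum _ fun w _ => Measurable.of_discrete]
        refine Finset.sum_congr rfl fun w _ => ?_
        rw [lintegral_add_left Measurable.of_discrete,
          lintegral_finsetSum _ fun w _ => Measurable.of_discrete]
    _ ≤ ∑ w : Fin M, (η + ∑ _w' ∈ Finset.univ.erase w, e) := by
        refine Finset.sum_le_sum fun w _ => add_le_add (hfirst w) ?_
        exact Finset.sum_le_sum fun w' hw' => hsecond w w' (Finset.ne_of_mem_erase hw')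
    _ ≤ ∑ _w : Fin M, (η + M * e) := by
        refine Finset.sum_le_sum fun w _ => add_le_add le_rfl ?_
        rw [Finset.sum_const, nsmul_eq_mul]
        gcongr
        exact (Finset.card_le_univ _).trans_eq (Fintype.card_fin M)
    _ = M * (η + M * e) := by simp [mul_add]

/-- Some codebook outside a given set of small probability has a small probability of error. -/
lemma exists_codebook {M : ℕ} [NeZero M] (μ : Measure X) [IsProbabilityMeasure μ]
    (ν : Measure Ω) [IsProbabilityMeasure ν] {recv : X → Ω → Y} (hrecv : ∀ x, Measurable (recv x))
    {S : X → Y → Prop} (hS : ∀ x, MeasurableSet {y | S x y}) {e η β : ℝ}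
    (he0 : 0 ≤ e) (hη0 : 0 ≤ η) (hβ0 : 0 ≤ β)
    (he : ∀ y, μ {x | S x y} ≤ ENNReal.ofReal e)
    (hη : ∫⁻ x, ν {ω | ¬ S x (recv x ω)} ∂μ ≤ ENNReal.ofReal η)
    {bad : Set (Fin M → X)} (hβ : (Measure.pi fun _ : Fin M => μ) bad ≤ ENNReal.ofReal β)
    (hlt : η + M * e + β < 1) :
    ∃ c : Fin M → X, c ∉ bad ∧
      (∑ w, ν.real {ω | firstPassing (fun w => S (c w)) (recv (c w) ω) ≠ w}) / M
        ≤ η + M * e + β := by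
  have hM0 : (M : ENNReal) ≠ 0 := by simpa using NeZero.ne M
  have hM : (0 : ℝ) < M := by exact_mod_cast NeZero.pos M
  have herr := lintegral_sum_error_le (M := M) μ ν hrecv hS he hη
  -- The error probability, with a penalty of one for the bad codebooks.
  let F : (Fin M → X) → ENNReal := fun c =>
    (∑ w, ν {ω | firstPassing (fun w => S (c w)) (recv (c w) ω) ≠ w}) / M + bad.indicator 1 c
  have hF : ∫⁻ c, F c ∂(Measure.pi fun _ : Fin M => μ) ≤ ENNReal.ofReal (η + M * e + β) := by
    rw [lintegral_add_left Measurable.of_discrete,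
      lintegral_indicator_one (Set.toFinite bad).measurableSet,
      ENNReal.ofReal_add (by positivity) hβ0]
    refine add_le_add ?_ hβ
    simp_rw [div_eq_mul_inv]
    rw [lintegral_mul_const _ Measurable.of_discrete, ENNReal.ofReal_add hη0 (by positivity),
      ENNReal.ofReal_mul hM.le, ENNReal.ofReal_natCast]
    calc _ ≤ (M * (ENNReal.ofReal η + M * ENNReal.ofReal e)) * (M : ENNReal)⁻¹ := by gcongr
      _ = _ := by
        rw [mul_comm (M : ENNReal), mul_assoc, ENNReal.mul_inv_cancel hM0 (by simp), mul_one]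
  obtain ⟨c, hc⟩ := exists_le_lintegral (μ := Measure.pi fun _ : Fin M => μ) (f := F)
    Measurable.of_discrete.aemeasurable
  have hc' := hc.trans hF
  refine ⟨c, fun hbad => ?_, ?_⟩
  · have h1 : (1 : ENNReal) ≤ F c := by
      simp only [F, Set.indicator_of_mem hbad, Pi.one_apply]
      exact le_add_self
    have := h1.trans hc'
    rw [ENNReal.one_le_ofReal] at this
    linarith
  · have h1 : (∑ w, ν {ω | firstPassing (fun w => S (c w)) (recv (c w) ω) ≠ w}) / M ≤
        ENNReal.ofReal (η + M * e + β) := le_self_add.trans hc'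
    have h2 := ENNReal.toReal_le_of_le_ofReal (by positivity) h1
    rw [ENNReal.toReal_div, ENNReal.toReal_sum fun w _ => measure_ne_top _ _,
      ENNReal.toReal_natCast] at h2
    exact h2

end RandomCoding

/-! ### Laws of large numbers -/

lemma integral_sum_pi {ι : Type*} [Fintype ι] {Ω : Type*} [MeasurableSpace Ω] (ρ : Measure Ω)
    [IsProbabilityMeasure ρ] {f : ι → Ω → ℝ} (hf : ∀ i, Integrable (f i) ρ) :
    ∫ ω, ∑ i, f i (ω i) ∂(Measure.pi fun _ : ι => ρ) = ∑ i, ∫ x, f i x ∂ρ := by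
  have hi (i : ι) := measurePreserving_eval (fun _ : ι => ρ) i
  have hf' (i : ι) : Integrable (fun ω : ι → Ω => f i (ω i)) (Measure.pi fun _ => ρ) :=
    (hi i).integrable_comp_of_integrable (hf i)
  rw [integral_finsetSum _ fun i _ => hf' i]
  refine Finset.sum_congr rfl fun i _ => ?_
  have := integral_map (hi i).aemeasurable (f := f i)
    (by rw [(hi i).map_eq]; exact (hf i).aestronglyMeasurable)
  rw [(hi i).map_eq] at this
  exact this.symm

/-- Chebyshev's inequality for a sum of independent variables. -/
lemma chebyshev_pi {ι : Type*} [Fintype ι] {Ω : Type*} [MeasurableSpace Ω] (ρ : Measure Ω)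
    [IsProbabilityMeasure ρ] {f : ι → Ω → ℝ} (hf : ∀ i, MemLp (f i) 2 ρ) {c : ℝ} (hc : 0 < c) :
    (Measure.pi fun _ : ι => ρ) {ω | c ≤ |∑ i, f i (ω i) - ∑ i, ∫ x, f i x ∂ρ|} ≤
      ENNReal.ofReal ((∑ i, Var[f i; ρ]) / c ^ 2) := by
  have hi (i : ι) := measurePreserving_eval (fun _ : ι => ρ) i
  have hf' (i : ι) : MemLp (fun ω : ι → Ω => f i (ω i)) 2 (Measure.pi fun _ => ρ) :=
    (hf i).comp_measurePreserving (hi i)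
  have hmem : MemLp (∑ i, fun ω : ι → Ω => f i (ω i)) 2 (Measure.pi fun _ => ρ) :=
    memLp_finsetSum' _ fun i _ => hf' i
  have hmean : ∫ ω, (∑ i, fun ω : ι → Ω => f i (ω i)) ω ∂(Measure.pi fun _ => ρ) =
      ∑ i, ∫ x, f i x ∂ρ := by
    simp_rw [Finset.sum_apply]
    exact integral_sum_pi ρ fun i => (hf i).integrable (by norm_num)
  have h := meas_ge_le_variance_div_sq hmem hc
  rw [hmean, variance_sum_pi hf] at h
  simpa only [Finset.sum_apply] using h

/-- Chebyshev's inequality for a sum over `T` blocks of `m` independent variables. -/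
lemma chebyshev_pi_pi {m T : ℕ} {Ω : Type*} [MeasurableSpace Ω] (ρ : Measure Ω)
    [IsProbabilityMeasure ρ] {f : Fin T → Fin m → Ω → ℝ} (hf : ∀ t i, MemLp (f t i) 2 ρ) {c V : ℝ}
    (hc : 0 < c) (hV : ∀ t i, Var[f t i; ρ] ≤ V) :
    (Measure.pi fun _ : Fin T => Measure.pi fun _ : Fin m => ρ)
      {ω | c ≤ |∑ t, ∑ i, f t i (ω t i) - ∑ t, ∑ i, ∫ x, f t i x ∂ρ|} ≤
      ENNReal.ofReal (m * T * V / c ^ 2) := by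
  have hmem (t : Fin T) : MemLp (∑ i, fun ω : Fin m → Ω => f t i (ω i)) 2
      (Measure.pi fun _ : Fin m => ρ) :=
    memLp_finsetSum' _ fun i _ =>
      (hf t i).comp_measurePreserving (measurePreserving_eval (fun _ : Fin m => ρ) i)
  have h := chebyshev_pi (Measure.pi fun _ : Fin m => ρ) hmem hc
  simp_rw [variance_sum_pi (hf _), Finset.sum_apply,
    integral_sum_pi ρ fun i => (hf _ i).integrable (by norm_num)] at h
  refine h.trans (ENNReal.ofReal_le_ofReal ?_)
  gcongr
  calc ∑ t, ∑ i, Var[f t i; ρ] ≤ ∑ _t : Fin T, ∑ _i : Fin m, V :=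
        Finset.sum_le_sum fun t _ => Finset.sum_le_sum fun i _ => hV t i
    _ = m * T * V := by simp; ring

/-! ### Random codes for the channel -/

section ChannelCoding

variable {N : ℕ} {B : Finset ℂ}

/-- The law of a channel input with distribution `p`. -/
noncomputable def inputLaw (p : B → ℝ) : Measure B :=
  ∑ x : B, ENNReal.ofReal (p x) • Measure.dirac x

lemma isProbabilityMeasure_inputLaw {p : B → ℝ} (hp : p ∈ stdSimplex ℝ B) :
    IsProbabilityMeasure (inputLaw p) := by
  constructor
  simp only [inputLaw, Measure.coe_finsetSum, Finset.sum_apply, Measure.smul_apply, measure_univ,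
    smul_eq_mul, mul_one]
  exact sum_ofReal_eq_one hp

lemma integral_inputLaw {p : B → ℝ} (hp : p ∈ stdSimplex ℝ B) (f : B → ℝ) :
    ∫ x, f x ∂inputLaw p = ∑ x, p x * f x := by
  rw [inputLaw, integral_finsetSum_measure fun x _ =>
    (integrable_dirac (by simp)).smul_measure ENNReal.ofReal_ne_top]
  refine Finset.sum_congr rfl fun x _ => ?_
  rw [integral_smul_measure, integral_dirac, ENNReal.toReal_ofReal (hp.1 x), smul_eq_mul]

/-- The information density of a block of `T m` channel uses. -/
noncomputable def blockInfo {m T : ℕ} (p : B → ℝ) (h : Fin N → ℂ) (x : Fin T → Fin m → B)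
    (y : Fin T → Fin m → Fin N → ℂ) : ℝ :=
  ∑ t, ∑ i, infoDensity p h (x t i) (y t i)

/-- A random codeword that is independent of the output has block information density above `γ`
with probability at most `exp (-γ)`. -/
lemma measure_lt_blockInfo_le {m T : ℕ} {p : B → ℝ} (hp : p ∈ stdSimplex ℝ B) (h : Fin N → ℂ)
    (γ : ℝ) (y : Fin T → Fin m → Fin N → ℂ) :
    (Measure.pi fun _ : Fin T => Measure.pi fun _ : Fin m => inputLaw p)
      {x | γ < blockInfo p h x y} ≤ ENNReal.ofReal (Real.exp (-γ)) := by
  have := isProbabilityMeasure_inputLaw hp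
  set μ := Measure.pi fun _ : Fin T => Measure.pi fun _ : Fin m => inputLaw p
  have hint : ∫ x, Real.exp (blockInfo p h x y) ∂μ = 1 := by
    simp_rw [blockInfo, Real.exp_sum]
    rw [integral_fintype_prod_eq_prod (f := fun t (x : Fin m → B) =>
      ∏ i, Real.exp (infoDensity p h (x i) (y t i)))]
    refine Finset.prod_eq_one fun t _ => ?_
    rw [integral_fintype_prod_eq_prod (f := fun i (x : B) =>
      Real.exp (infoDensity p h x (y t i)))]
    refine Finset.prod_eq_one fun i _ => ?_
    rw [integral_inputLaw hp, sum_mul_exp_infoDensity hp]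
  have hmarkov := mul_meas_ge_le_integral_of_nonneg (μ := μ)
    (f := fun x => Real.exp (blockInfo p h x y))
    (Filter.Eventually.of_forall fun x => (Real.exp_pos _).le) Integrable.of_finite (Real.exp γ)
  rw [hint] at hmarkov
  have hsub : {x | γ < blockInfo p h x y} ⊆ {x | Real.exp γ ≤ Real.exp (blockInfo p h x y)} :=
    fun x hx => Real.exp_le_exp.2 (le_of_lt hx)
  refine (measure_mono hsub).trans ?_
  rw [← ofReal_measureReal]
  refine ENNReal.ofReal_le_ofReal ?_
  rw [Real.exp_neg, ← one_div, le_div_iff₀' (Real.exp_pos γ)]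
  exact hmarkov

/-- The law of large numbers for the block information density: first for the noise, given the
codeword, and then for the random codeword. -/
lemma exists_lintegral_blockInfo_le {p : B → ℝ} (hp : p ∈ stdSimplex ℝ B) (h : Fin N → ℂ) :
    ∃ C : ℝ, 0 ≤ C ∧ ∀ (m T : ℕ) (ε : ℝ), 0 < (m * T : ℝ) → 0 < ε →
      ∫⁻ x, noise N m T {Z | ¬ m * T * (meanInfo p h - 2 * ε) <
          blockInfo p h x fun t i => (x t i : ℂ) • h + Z t i}
        ∂(Measure.pi fun _ : Fin T => Measure.pi fun _ : Fin m => inputLaw p) ≤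
      ENNReal.ofReal (C / (m * T * ε ^ 2)) := by
  have := isProbabilityMeasure_inputLaw hp
  -- The conditional mean and variance given the input.
  let a : B → ℝ := fun x => ∫ z, infoDensity p h x ((x : ℂ) • h + z) ∂noiseVec N
  let v : B → ℝ := fun x => Var[fun z => infoDensity p h x ((x : ℂ) • h + z); noiseVec N]
  have hv0 : 0 ≤ ∑ x, v x := Finset.sum_nonneg fun x _ => variance_nonneg _ _
  have ha0 : 0 ≤ Var[a; inputLaw p] := variance_nonneg _ _
  refine ⟨∑ x, v x + Var[a; inputLaw p], by positivity, fun m T ε hn hε => ?_⟩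
  have hc : 0 < m * T * ε := by positivity
  set μ := Measure.pi fun _ : Fin T => Measure.pi fun _ : Fin m => inputLaw p
  have hmean : ∫ x, a x ∂inputLaw p = meanInfo p h := integral_inputLaw hp a
  have hbad : μ {x | m * T * ε ≤ |∑ t, ∑ i, a (x t i) - m * T * meanInfo p h|} ≤
      ENNReal.ofReal (m * T * Var[a; inputLaw p] / (m * T * ε) ^ 2) := by
    have h1 := chebyshev_pi_pi (m := m) (T := T) (inputLaw p) (f := fun _ _ => a)
      (fun _ _ => MemLp.of_discrete) hc (V := Var[a; inputLaw p]) fun _ _ => le_rfl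
    have h2 : ∑ _t : Fin T, ∑ _i : Fin m, ∫ x, a x ∂inputLaw p = m * T * meanInfo p h := by
      rw [hmean]; simp; ring
    rw [h2] at h1
    exact h1
  have hnoise (x : Fin T → Fin m → B) :
      noise N m T {Z | m * T * ε ≤ |(blockInfo p h x fun t i => (x t i : ℂ) • h + Z t i) -
        ∑ t, ∑ i, a (x t i)|} ≤
      ENNReal.ofReal (m * T * (∑ x, v x) / (m * T * ε) ^ 2) :=
    chebyshev_pi_pi (m := m) (T := T) (noiseVec N)
      (f := fun t i z => infoDensity p h (x t i) ((x t i : ℂ) • h + z))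
      (fun t i => memLp_infoDensity hp h (x t i)) hc
      fun t i => Finset.single_le_sum (f := v) (fun x _ => variance_nonneg _ _)
        (Finset.mem_univ (x t i))
  set bad := {x : Fin T → Fin m → B |
    m * T * ε ≤ |∑ t, ∑ i, a (x t i) - m * T * meanInfo p h|}
  have hpoint (x : Fin T → Fin m → B) :
      noise N m T {Z | ¬ m * T * (meanInfo p h - 2 * ε) <
          blockInfo p h x fun t i => (x t i : ℂ) • h + Z t i} ≤
        bad.indicator 1 x + ENNReal.ofReal (m * T * (∑ x, v x) / (m * T * ε) ^ 2) := by
    by_cases hx : x ∈ bad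
    · rw [Set.indicator_of_mem hx]
      exact prob_le_one.trans le_self_add
    · refine le_trans (measure_mono fun Z hZ => ?_) ((hnoise x).trans le_add_self)
      have hx' : |∑ t, ∑ i, a (x t i) - m * T * meanInfo p h| < m * T * ε := not_le.1 hx
      have hZ' : (blockInfo p h x fun t i => (x t i : ℂ) • h + Z t i) ≤
          m * T * (meanInfo p h - 2 * ε) := not_lt.1 hZ
      show m * T * ε ≤ |(blockInfo p h x fun t i => (x t i : ℂ) • h + Z t i) -
        ∑ t, ∑ i, a (x t i)|
      have h3 := (abs_lt.1 hx').1
      rw [abs_sub_comm]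
      refine le_trans ?_ (le_abs_self _)
      linarith
  refine (lintegral_mono hpoint).trans ?_
  rw [lintegral_add_right _ measurable_const,
    lintegral_indicator_one (Set.toFinite bad).measurableSet,
    lintegral_const, measure_univ, mul_one]
  refine (add_le_add hbad le_rfl).trans_eq ?_
  rw [← ENNReal.ofReal_add (by positivity) (by positivity)]
  congr 1
  field_simp
  ring

/-- The input distribution `p` allows random codebooks to meet the power constraint: either with
a margin, or symbol by symbol. -/
def HasPowerMargin (P : ℝ) (p : B → ℝ) : Prop :=
  ∑ x : B, p x * ‖(x : ℂ)‖ ^ 2 < P ∨ ∀ x, p x ≠ 0 → ‖(x : ℂ)‖ ^ 2 ≤ P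

/-- The power of each symbol of a random codebook, averaged over the messages, concentrates as the
number of messages grows. -/
lemma exists_measure_power_le {P : ℝ} {p : B → ℝ} (hp : p ∈ stdSimplex ℝ B)
    (hP : HasPowerMargin P p) :
    ∃ C : ℝ, 0 ≤ C ∧ ∀ (M m T : ℕ), 0 < M → ∀ (t : Fin T) (i : Fin m),
      (Measure.pi fun _ : Fin M => Measure.pi fun _ : Fin T => Measure.pi fun _ : Fin m =>
        inputLaw p) {c | P < (∑ w, ‖(c w t i : ℂ)‖ ^ 2) / M} ≤ ENNReal.ofReal (C / M) := by
  have := isProbabilityMeasure_inputLaw hp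
  let u : B → ℝ := fun x => ‖(x : ℂ)‖ ^ 2
  have heval (m T : ℕ) (t : Fin T) (i : Fin m) : MeasurePreserving
      (fun x : Fin T → Fin m → B => x t i)
      (Measure.pi fun _ : Fin T => Measure.pi fun _ : Fin m => inputLaw p) (inputLaw p) :=
    (measurePreserving_eval (fun _ : Fin m => inputLaw p) i).comp
      (measurePreserving_eval (fun _ : Fin T => Measure.pi fun _ : Fin m => inputLaw p) t)
  rcases hP with hP | hP
  · set δ := P - ∑ x : B, p x * u x with hδ
    have hδ0 : 0 < δ := sub_pos.2 hP
    have hV0 : 0 ≤ Var[u; inputLaw p] := variance_nonneg _ _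
    refine ⟨Var[u; inputLaw p] / δ ^ 2, by positivity, fun M m T hM t i => ?_⟩
    have hM' : (0 : ℝ) < M := by exact_mod_cast hM
    set μ := Measure.pi fun _ : Fin T => Measure.pi fun _ : Fin m => inputLaw p
    have h1 := chebyshev_pi (ι := Fin M) μ (f := fun _ x => u (x t i))
      (fun _ => MemLp.of_discrete) (mul_pos hM' hδ0)
    have hmean : ∫ x, u (x t i) ∂μ = ∑ x : B, p x * u x := by
      rw [← integral_inputLaw hp, ← (heval m T t i).map_eq,
        integral_map (heval m T t i).aemeasurable Measurable.of_discrete.aestronglyMeasurable]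
    have hvar : Var[fun x => u (x t i); μ] = Var[u; inputLaw p] := by
      rw [← (heval m T t i).map_eq, variance_map Measurable.of_discrete.aemeasurable
        (heval m T t i).aemeasurable]
      rfl
    rw [hvar, hmean] at h1
    refine (measure_mono fun c hc => ?_).trans (h1.trans_eq ?_)
    · have hc' : P < (∑ w, u (c w t i)) / M := hc
      rw [lt_div_iff₀ hM'] at hc'
      show M * δ ≤ |∑ w, u (c w t i) - ∑ _w : Fin M, ∑ x : B, p x * u x|
      refine le_trans ?_ (le_abs_self _)
      rw [Finset.sum_const, Finset.card_univ, Fintype.card_fin, nsmul_eq_mul, hδ]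
      linarith
    · rw [Finset.sum_const, Finset.card_univ, Fintype.card_fin, nsmul_eq_mul]
      congr 1
      field_simp
  · refine ⟨0, le_rfl, fun M m T hM t i => ?_⟩
    have hM' : (0 : ℝ) < M := by exact_mod_cast hM
    have h0 : ∀ᵐ x ∂inputLaw p, u x ≤ P := by
      rw [ae_iff, inputLaw]
      simp only [Measure.coe_finsetSum, Finset.sum_apply, Measure.smul_apply, smul_eq_mul,
        Finset.sum_eq_zero_iff, Finset.mem_univ, true_imp_iff, mul_eq_zero]
      intro x
      rcases eq_or_ne (p x) 0 with hx | hx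
      · left; simp [hx]
      · right
        rw [Measure.dirac_apply' _ (Set.toFinite _).measurableSet, Set.indicator_of_notMem]
        simpa using hP x hx
    have h1 (w : Fin M) := ((heval m T t i).comp (measurePreserving_eval (fun _ : Fin M =>
      Measure.pi fun _ : Fin T => Measure.pi fun _ : Fin m => inputLaw p)
        w)).quasiMeasurePreserving.ae h0
    have h2 := ae_all_iff.2 h1
    rw [zero_div, ENNReal.ofReal_zero, nonpos_iff_eq_zero]
    refine measure_mono_null (fun c hc => ?_) (ae_iff.1 h2)
    intro hcon
    have hc' : P < (∑ w, u (c w t i)) / M := hc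
    rw [lt_div_iff₀ hM'] at hc'
    have h3 : ∑ w, u (c w t i) ≤ ∑ _w : Fin M, P := Finset.sum_le_sum fun w _ => hcon w
    rw [Finset.sum_const, Finset.card_univ, Fintype.card_fin, nsmul_eq_mul] at h3
    linarith

/-- Codes of any rate below the mean information density, with a fixed configuration. -/
lemma eventually_exists_code {K m : ℕ} (hm : 0 < m) (H : Matrix (Fin N) (Fin K) ℂ)
    (g : Fin K → ℂ) {A : Finset ℝ} (θ : Fin K → A) {P : ℝ} {p : B → ℝ} (hp : p ∈ stdSimplex ℝ B)
    (hP : HasPowerMargin P p) {r τ : ℝ} (hr0 : 0 < r) (hr : r < meanInfo p (effChannel H g θ))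
    (hτ : 0 < τ) :
    ∀ᶠ T : ℕ in Filter.atTop, ∃ c : Code N K m T A B, (∀ w t, c.phase w t = θ) ∧
      c.PowerConstraint P ∧ r / Real.log 2 ≤ c.rate ∧ c.errorProb H g ≤ τ := by
  have := isProbabilityMeasure_inputLaw hp
  set h := effChannel H g θ
  obtain ⟨C₁, hC₁, hLLN⟩ := exists_lintegral_blockInfo_le hp h
  obtain ⟨C₂, hC₂, hpow⟩ := exists_measure_power_le hp hP
  set ε := (meanInfo p h - r) / 4 with hε
  have hε0 : 0 < ε := by rw [hε]; linarith
  have hlim : Filter.Tendsto (fun x : ℝ => C₁ / (x * ε ^ 2) + 2 * Real.exp (-(2 * ε * x)) +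
      C₂ / r * ((r * x) ^ 1 * Real.exp (-(r * x)))) Filter.atTop (nhds 0) := by
    have h1 : Filter.Tendsto (fun x : ℝ => C₁ / (x * ε ^ 2)) Filter.atTop (nhds 0) :=
      Filter.Tendsto.const_div_atTop (Filter.tendsto_id.atTop_mul_const (by positivity)) _
    have h2 : Filter.Tendsto (fun x : ℝ => 2 * Real.exp (-(2 * ε * x))) Filter.atTop (nhds 0) := by
      have := (Real.tendsto_exp_neg_atTop_nhds_zero.comp
        (Filter.tendsto_id.const_mul_atTop (show 0 < 2 * ε by positivity))).const_mul 2
      simpa using this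
    have h3 : Filter.Tendsto (fun x : ℝ => C₂ / r * ((r * x) ^ 1 * Real.exp (-(r * x))))
        Filter.atTop (nhds 0) := by
      have := ((Real.tendsto_pow_mul_exp_neg_atTop_nhds_zero 1).comp
        (Filter.tendsto_id.const_mul_atTop hr0)).const_mul (C₂ / r)
      simpa using this
    simpa using (h1.add h2).add h3
  have hn : Filter.Tendsto (fun T : ℕ => (m * T : ℝ)) Filter.atTop Filter.atTop :=
    tendsto_natCast_atTop_atTop.const_mul_atTop (by exact_mod_cast hm)
  filter_upwards [(hlim.comp hn).eventually_lt_const (show 0 < min τ 1 by positivity),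
    hn.eventually_gt_atTop 0] with T hsmall hnT
  simp only [Function.comp_apply] at hsmall
  set n : ℝ := m * T
  -- The number of messages.
  set M := ⌈Real.exp (n * r)⌉₊ with hM
  have hM0 : 0 < M := Nat.ceil_pos.2 (Real.exp_pos _)
  have : NeZero M := ⟨hM0.ne'⟩
  have hMge : Real.exp (n * r) ≤ M := Nat.le_ceil _
  have hMle : (M : ℝ) ≤ 2 * Real.exp (n * r) := by
    have h1 : (M : ℝ) < Real.exp (n * r) + 1 := Nat.ceil_lt_add_one (Real.exp_pos _).le
    have h2 : 1 ≤ Real.exp (n * r) := Real.one_le_exp (by positivity)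
    linarith
  set γ := n * (meanInfo p h - 2 * ε) with hγ
  let μ := Measure.pi fun _ : Fin T => Measure.pi fun _ : Fin m => inputLaw p
  let bad : Set (Fin M → Fin T → Fin m → B) :=
    ⋃ q : Fin T × Fin m, {c | P < (∑ w, ‖(c w q.1 q.2 : ℂ)‖ ^ 2) / M}
  have hbad : (Measure.pi fun _ : Fin M => μ) bad ≤ ENNReal.ofReal (n * (C₂ / M)) := by
    refine (measure_iUnion_fintype_le _ _).trans ?_
    refine (Finset.sum_le_sum fun q _ => hpow M m T hM0 q.1 q.2).trans_eq ?_
    rw [Finset.sum_const, Finset.card_univ, Fintype.card_prod, Fintype.card_fin, Fintype.card_fin,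
      nsmul_eq_mul, ← ENNReal.ofReal_natCast, ← ENNReal.ofReal_mul (by positivity)]
    congr 2
    push_cast
    ring
  have hsmall' : C₁ / (n * ε ^ 2) + M * Real.exp (-γ) + n * (C₂ / M) < min τ 1 := by
    refine lt_of_le_of_lt (add_le_add (add_le_add le_rfl ?_) ?_) hsmall
    · calc M * Real.exp (-γ) ≤ 2 * Real.exp (n * r) * Real.exp (-γ) := by gcongr
        _ = 2 * Real.exp (-(2 * ε * n)) := by
          rw [mul_assoc, ← Real.exp_add, hγ]
          congr 2
          rw [hε]; ring
    · calc n * (C₂ / M) ≤ n * (C₂ / Real.exp (n * r)) := by gcongr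
        _ = C₂ / r * ((r * n) ^ 1 * Real.exp (-(r * n))) := by
          rw [Real.exp_neg, mul_comm n r]
          field_simp
  have hmeasInfo (x : Fin T → Fin m → B) : Measurable (blockInfo p h x) := by
    unfold blockInfo; fun_prop
  obtain ⟨c, hcbad, hcerr⟩ := exists_codebook (M := M) μ (noise N m T)
    (recv := fun x Z t i => (x t i : ℂ) • h + Z t i) (fun x => by fun_prop)
    (S := fun x y => γ < blockInfo p h x y)
    (fun x => measurableSet_lt measurable_const (hmeasInfo x))
    (Real.exp_pos (-γ)).le (by positivity) (by positivity)
    (measure_lt_blockInfo_le hp h γ) (hLLN m T ε hnT hε0) hbad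
    (hsmall'.trans_le (min_le_right _ _))
  refine ⟨⟨M, c, fun _ _ => θ, firstPassing fun w y => γ < blockInfo p h (c w) y,
    measurable_firstPassing fun w => measurableSet_lt measurable_const (hmeasInfo (c w))⟩,
    fun _ _ => rfl, fun t i => ?_, ?_, ?_⟩
  · by_contra hcon
    exact hcbad (Set.mem_iUnion.2 ⟨(t, i), not_le.1 hcon⟩)
  · show r / Real.log 2 ≤ Real.logb 2 M / (m * T : ℝ)
    have hlog : n * r ≤ Real.log M :=
      (Real.le_log_iff_exp_le (by exact_mod_cast hM0)).2 hMge
    have hlog2 : 0 < Real.log 2 := Real.log_pos (by norm_num)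
    rw [le_div_iff₀ hnT, Real.logb, div_mul_eq_mul_div]
    gcongr
    linarith
  · refine le_trans hcerr (hsmall'.le.trans (min_le_left _ _))

/-- The code with a single message. -/
noncomputable def trivialCode {K : ℕ} (m T : ℕ) {A : Finset ℝ} (θ : Fin K → A) (x : B) :
    Code N K m T A B where
  M := 1
  symbol _ _ _ := x
  phase _ _ := θ
  decode _ := 0
  measurable_decode := measurable_const

lemma powerConstraint_trivialCode {K m T : ℕ} {A : Finset ℝ} (θ : Fin K → A) {P : ℝ} {x : B}
    (hx : ‖(x : ℂ)‖ ^ 2 ≤ P) : (trivialCode m T θ x : Code N K m T A B).PowerConstraint P := by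
  intro t i
  change (∑ _w : Fin 1, ‖(x : ℂ)‖ ^ 2) / ((1 : ℕ) : ℝ) ≤ P
  simpa using hx

lemma errorProb_trivialCode {K m T : ℕ} {A : Finset ℝ} (H : Matrix (Fin N) (Fin K) ℂ)
    (g : Fin K → ℂ) (θ : Fin K → A) (x : B) :
    (trivialCode m T θ x : Code N K m T A B).errorProb H g = 0 := by
  change (∑ w : Fin 1, (noise N m T).real {_Z | (0 : Fin 1) ≠ w}) / ((1 : ℕ) : ℝ) = 0
  simp

/-- Rates achievable up to every slack `δ` and error probability `δ` are achievable. -/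
lemma achievable_of_eventually_exists_code {K m : ℕ} (H : Matrix (Fin N) (Fin K) ℂ)
    (g : Fin K → ℂ) {A : Finset ℝ} (θ : Fin K → A) {P R : ℝ} {x₀ : B} (hx₀ : ‖(x₀ : ℂ)‖ ^ 2 ≤ P)
    (hcode : ∀ δ > 0, ∀ᶠ T : ℕ in Filter.atTop, ∃ c : Code N K m T A B,
      (∀ w t, c.phase w t = θ) ∧ c.PowerConstraint P ∧ R - δ ≤ c.rate ∧ c.errorProb H g ≤ δ) :
    AchievableWithFixedConfig H g B P m θ R := by
  classical
  let Good : ∀ T : ℕ, ℕ → Code N K m T A B → Prop := fun T k c =>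
    R - 1 / ((k : ℝ) + 1) ≤ c.rate ∧ c.errorProb H g ≤ 1 / ((k : ℝ) + 1)
  let Q : ℕ → ℕ → Prop := fun T k => ∃ c : Code N K m T A B,
    (∀ w t, c.phase w t = θ) ∧ c.PowerConstraint P ∧ (k = 0 ∨ Good T (k - 1) c)
  -- At length `m T`, take a code for the best accuracy `k ≤ T` that is available.
  let k : ℕ → ℕ := fun T => Nat.findGreatest (Q T) T
  have hQ0 (T : ℕ) : Q T 0 := by
    exact ⟨trivialCode m T θ x₀, fun _ _ => rfl, powerConstraint_trivialCode θ hx₀, Or.inl rfl⟩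
  have hk (T : ℕ) : Q T (k T) := Nat.findGreatest_spec (Nat.zero_le T) (hQ0 T)
  choose c hphase hpower hgood using hk
  have hkgood (δ : ℝ) (hδ : 0 < δ) : ∀ᶠ T in Filter.atTop,
      R - δ ≤ (c T).rate ∧ (c T).errorProb H g ≤ δ := by
    obtain ⟨j, hj⟩ := exists_nat_one_div_lt hδ
    filter_upwards [hcode (1 / ((j : ℝ) + 1)) (by positivity), Filter.eventually_ge_atTop (j + 1)]
      with T hT hjT
    have hkj : j + 1 ≤ k T := by
      obtain ⟨c, h1, h2, h3⟩ := hT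
      exact Nat.le_findGreatest hjT ⟨c, h1, h2, Or.inr h3⟩
    have hle : 1 / (((k T - 1 : ℕ) : ℝ) + 1) ≤ 1 / ((j : ℝ) + 1) := by
      apply one_div_le_one_div_of_le (by positivity)
      have : j ≤ k T - 1 := by omega
      have : (j : ℝ) ≤ ((k T - 1 : ℕ) : ℝ) := by exact_mod_cast this
      linarith
    have hG := (hgood T).resolve_left (by omega)
    exact ⟨by linarith [hG.1], by linarith [hG.2]⟩
  refine ⟨c, hphase, hpower, fun δ hδ => (hkgood δ hδ).mono fun T hT => hT.1, ?_⟩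
  rw [Metric.tendsto_nhds]
  intro δ hδ
  filter_upwards [hkgood (δ / 2) (by positivity)] with T hT
  have h0 : 0 ≤ (c T).errorProb H g :=
    div_nonneg (Finset.sum_nonneg fun _ _ => measureReal_nonneg) (Nat.cast_nonneg _)
  rw [Real.dist_eq, sub_zero, abs_of_nonneg h0]
  linarith [hT.2]

lemma exists_norm_sq_le {P : ℝ} {p : B → ℝ} (hp : IsFeasible P p) :
    ∃ x₀ : B, ‖(x₀ : ℂ)‖ ^ 2 ≤ P ∧ ∀ x : B, ‖(x₀ : ℂ)‖ ^ 2 ≤ ‖(x : ℂ)‖ ^ 2 := by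
  have hne : Nonempty B := by
    by_contra hcon
    rw [not_nonempty_iff] at hcon
    simpa using hp.1.2
  obtain ⟨x₀, hx₀⟩ := Finite.exists_min fun x : B => ‖(x : ℂ)‖ ^ 2
  refine ⟨x₀, le_trans ?_ hp.2, hx₀⟩
  calc ‖(x₀ : ℂ)‖ ^ 2 = ∑ x, p x * ‖(x₀ : ℂ)‖ ^ 2 := by rw [← Finset.sum_mul, hp.1.2, one_mul]
    _ ≤ _ := Finset.sum_le_sum fun x _ => mul_le_mul_of_nonneg_left (hx₀ x) (hp.1.1 x)

/-- A feasible distribution can be approximated by distributions with a power margin: mix in the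
symbol of least power, unless all the symbols used have power exactly `P`. -/
lemma exists_hasPowerMargin {P : ℝ} {p : B → ℝ} (hp : IsFeasible P p) (h : Fin N → ℂ) {r : ℝ}
    (hr : r < meanInfo p h) :
    ∃ q ∈ stdSimplex ℝ B, HasPowerMargin P q ∧ r < meanInfo q h := by
  obtain ⟨x₀, hx₀P, hx₀⟩ := exists_norm_sq_le hp
  rcases hx₀P.eq_or_lt with heq | hlt
  · refine ⟨p, hp.1, Or.inr fun x hx => ?_, hr⟩
    -- The excess power over the minimum `P` has mean zero, so it vanishes where `p` does not.
    have h1 : ∑ x, p x * (‖(x : ℂ)‖ ^ 2 - P) ≤ 0 := by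
      simp_rw [mul_sub]
      rw [Finset.sum_sub_distrib, ← Finset.sum_mul, hp.1.2, one_mul]
      linarith [hp.2]
    have h2 (x : B) : 0 ≤ p x * (‖(x : ℂ)‖ ^ 2 - P) :=
      mul_nonneg (hp.1.1 x) (by linarith [hx₀ x])
    have h3 := (Finset.sum_eq_zero_iff_of_nonneg fun x _ => h2 x).1
      (le_antisymm h1 (Finset.sum_nonneg fun x _ => h2 x)) x (Finset.mem_univ x)
    have h4 := (mul_eq_zero.1 h3).resolve_left hx
    linarith
  · let d : B → ℝ := Pi.single x₀ 1
    have hd : d ∈ stdSimplex ℝ B := single_mem_stdSimplex ℝ x₀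
    let q : ℝ → B → ℝ := fun s => (1 - s) • p + s • d
    have hq (s : ℝ) (hs : s ∈ Set.Icc (0 : ℝ) 1) : q s ∈ stdSimplex ℝ B :=
      convex_stdSimplex ℝ B hp.1 hd (by linarith [hs.2]) hs.1 (by ring)
    have hcont : ContinuousOn (fun s => meanInfo (q s) h) (Set.Icc 0 1) :=
      (continuousOn_meanInfo h).comp (by fun_prop) hq
    have h0 : meanInfo (q 0) h = meanInfo p h := by simp [q]
    have hev : ∀ᶠ s in nhdsWithin (0 : ℝ) (Set.Icc 0 1), r < meanInfo (q s) h := by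
      have := hcont 0 (by simp)
      exact this.eventually_const_lt (hr.trans_eq h0.symm)
    rw [nhdsWithin_Icc_eq_nhdsGE (by norm_num : (0 : ℝ) < 1)] at hev
    have hev' : ∀ᶠ s in nhdsWithin (0 : ℝ) (Set.Ioi 0), r < meanInfo (q s) h :=
      hev.filter_mono (nhdsWithin_mono _ Set.Ioi_subset_Ici_self)
    have hIoo : ∀ᶠ s in nhdsWithin (0 : ℝ) (Set.Ioi 0), s ∈ Set.Ioo (0 : ℝ) 1 :=
      Ioo_mem_nhdsGT (by norm_num)
    obtain ⟨s, hs, hs01⟩ := (hev'.and hIoo).exists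
    refine ⟨q s, hq s ⟨hs01.1.le, hs01.2.le⟩, Or.inl ?_, hs⟩
    have hsum : ∑ x : B, q s x * ‖(x : ℂ)‖ ^ 2 =
        (1 - s) * ∑ x : B, p x * ‖(x : ℂ)‖ ^ 2 + s * ‖(x₀ : ℂ)‖ ^ 2 := by
      have : ∑ x : B, d x * ‖(x : ℂ)‖ ^ 2 = ‖(x₀ : ℂ)‖ ^ 2 := by
        simp [d, Pi.single_apply]
      rw [← this, Finset.mul_sum, Finset.mul_sum, ← Finset.sum_add_distrib]
      refine Finset.sum_congr rfl fun x _ => ?_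
      simp only [q, Pi.add_apply, Pi.smul_apply, smul_eq_mul]
      ring
    rw [hsum]
    have h5 := mul_le_mul_of_nonneg_left hp.2 (by linarith [hs01.2] : 0 ≤ 1 - s)
    have h6 := mul_lt_mul_of_pos_left hlt hs01.1
    linarith

/-- The coding theorem: the mutual information of a feasible input distribution is achievable. -/
lemma achievable_meanInfo {K m : ℕ} (hm : 0 < m) (H : Matrix (Fin N) (Fin K) ℂ)
    (g : Fin K → ℂ) {A : Finset ℝ} (θ : Fin K → A) {P : ℝ} {p : B → ℝ} (hp : IsFeasible P p) :
    AchievableWithFixedConfig H g B P m θ (meanInfo p (effChannel H g θ) / Real.log 2) := by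
  have hlog2 : 0 < Real.log 2 := Real.log_pos (by norm_num)
  obtain ⟨x₀, hx₀, -⟩ := exists_norm_sq_le hp
  refine achievable_of_eventually_exists_code H g θ hx₀ fun δ hδ => ?_
  set I := meanInfo p (effChannel H g θ)
  have hr : (I - δ * Real.log 2) / Real.log 2 = I / Real.log 2 - δ := by field_simp
  rcases le_or_gt (I - δ * Real.log 2) 0 with hI | hI
  · -- A rate that is not positive needs only one message.
    refine Filter.Eventually.of_forall fun T => ⟨trivialCode m T θ x₀, fun _ _ => rfl,
      powerConstraint_trivialCode θ hx₀, ?_, (errorProb_trivialCode H g θ x₀).trans_le hδ.le⟩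
    have : (trivialCode m T θ x₀ : Code N K m T A B).rate = 0 := by simp [Code.rate, trivialCode]
    rw [← hr, this]
    exact div_nonpos_of_nonpos_of_nonneg hI hlog2.le
  · obtain ⟨q, hq, hqP, hqr⟩ := exists_hasPowerMargin hp (effChannel H g θ)
      (show I - δ * Real.log 2 < I by linarith [mul_pos hδ hlog2])
    rw [← hr]
    exact eventually_exists_code hm H g θ hq hqP hI hqr hδ

end ChannelCoding

end RIS

theorem proposition2 (N K m : ℕ) (hm : 0 < m)
    (H : Matrix (Fin N) (Fin K) ℂ) (g : Fin K → ℂ)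
    (A : Finset ℝ) (hA : A.Nonempty) (B : Finset ℂ)
    (P : ℝ) (hP : 0 < P) (hB : ∃ p : B → ℝ, RIS.IsFeasible P p) :
    -- the expectations exist, and the expression minimized is the mutual information
    (∀ (p : B → ℝ) (θ : Fin K → A), RIS.IsFeasible P p →
      (∀ x : B, MeasureTheory.Integrable (RIS.fMaxSNR H g p x θ) (RIS.noiseVec N)) ∧
      RIS.mutualInfo (RIS.jointLaw H g p θ) ≠ ⊤ ∧
      RIS.mutualInfoBits H g p θ = -(N * Real.logb 2 (Real.exp 1)) - RIS.objective H g p θ) ∧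
    -- the minimum exists, and the resulting rate is the optimal mutual information and is
    -- achieved with any fixed configuration that maximizes the SNR
    ∃ v : ℝ,
      IsLeast {r : ℝ | ∃ (p : B → ℝ) (θ : Fin K → A),
        RIS.IsFeasible P p ∧ r = RIS.objective H g p θ} v ∧
      IsGreatest {r : ℝ | ∃ (p : B → ℝ) (θ : Fin K → A),
        RIS.IsFeasible P p ∧ r = RIS.mutualInfoBits H g p θ}
        (-(N * Real.logb 2 (Real.exp 1)) - v) ∧
      ∀ θ : Fin K → A, (∀ θ' : Fin K → A, RIS.snr H g P θ' ≤ RIS.snr H g P θ) →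
        RIS.AchievableWithFixedConfig H g B P m θ (-(N * Real.logb 2 (Real.exp 1)) - v) := by
  have hlog2 : 0 < Real.log 2 := Real.log_pos (by norm_num)
  have hlogb : Real.logb 2 (Real.exp 1) = 1 / Real.log 2 := by rw [Real.logb, Real.log_exp]
  have hbits (p : B → ℝ) (θ : Fin K → A) (hp : RIS.IsFeasible P p) :
      RIS.mutualInfoBits H g p θ = RIS.meanInfo p (RIS.effChannel H g θ) / Real.log 2 := by
    rw [← (RIS.mutualInfo_channelLaw hp.1 _).2]
    rfl
  have hrate (p : B → ℝ) (θ : Fin K → A) (hp : RIS.IsFeasible P p) :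
      -(N * Real.logb 2 (Real.exp 1)) - RIS.objective H g p θ =
        RIS.meanInfo p (RIS.effChannel H g θ) / Real.log 2 := by
    rw [RIS.objective_eq H g hp.1, hlogb]
    ring
  have : Nonempty A := hA.to_subtype
  -- A configuration of maximal SNR is optimal, together with its best input distribution.
  obtain ⟨θ₀, hθ₀⟩ := Finite.exists_max fun θ : Fin K → A => RIS.snr H g P θ
  obtain ⟨p₀, hp₀, hmax⟩ := RIS.exists_isFeasible_meanInfo_max hB (RIS.effChannel H g θ₀)
  have hmono (p : B → ℝ) (hp : RIS.IsFeasible P p) {θ θ' : Fin K → A}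
      (hle : RIS.snr H g P θ' ≤ RIS.snr H g P θ) :
      RIS.meanInfo p (RIS.effChannel H g θ') ≤ RIS.meanInfo p (RIS.effChannel H g θ) :=
    RIS.meanInfo_mono hp.1 (le_of_mul_le_mul_right hle hP)
  have hopt (p : B → ℝ) (θ : Fin K → A) (hp : RIS.IsFeasible P p) :
      RIS.meanInfo p (RIS.effChannel H g θ) / Real.log 2 ≤
        RIS.meanInfo p₀ (RIS.effChannel H g θ₀) / Real.log 2 :=
    div_le_div_of_nonneg_right ((hmono p hp (hθ₀ θ)).trans (hmax p hp)) hlog2.le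
  refine ⟨fun p θ hp => ⟨fun x => ?_, (RIS.mutualInfo_channelLaw hp.1 _).1,
    (hbits p θ hp).trans (hrate p θ hp).symm⟩, RIS.objective H g p₀ θ₀,
    ⟨⟨p₀, θ₀, hp₀, rfl⟩, ?_⟩, ⟨⟨p₀, θ₀, hp₀, ?_⟩, ?_⟩, fun θ hθ => ?_⟩
  · have := (RIS.integrable_log_mixDensity hp.1 (RIS.effChannel H g θ) x).div_const (Real.log 2)
    refine this.congr (Filter.Eventually.of_forall fun z => ?_)
    exact (RIS.fMaxSNR_eq_logb_mixDensity H g p x θ z).symm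
  · rintro _ ⟨p, θ, hp, rfl⟩
    have := hopt p θ hp
    rw [← hrate p θ hp, ← hrate p₀ θ₀ hp₀] at this
    linarith
  · rw [hrate p₀ θ₀ hp₀, hbits p₀ θ₀ hp₀]
  · rintro _ ⟨p, θ, hp, rfl⟩
    rw [hrate p₀ θ₀ hp₀, hbits p θ hp]
    exact hopt p θ hp
  · rw [hrate p₀ θ₀ hp₀, le_antisymm (hmono p₀ hp₀ (hθ θ₀)) (hmono p₀ hp₀ (hθ₀ θ))]
    exact RIS.achievable_meanInfo hm H g θ hp₀
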